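/- **Setting.** Let $d,T,m\ge 1$ be integers and $B>0$. For $t=1,\dots,T$, an adversary, who sees the whole history of the first $t-1$ rounds, selects a context $x_t\in[0,1]^d$ and a label $y_t\in[0,1]$; the learner sees $x_t$ (but not $y_t$), selects a probability distribution $w_t$ on $\mathcal P=\{0,\frac1m,\dots,1\}$, and a forecast $p_t\in\mathcal P$ is drawn from $w_t$; then $y_t$ is revealed. For a transcript $\pi_T=\{(x_t,y_t,p_t)\}_{t=1}^T$ and a class $\mathcal H$ of functions $[0,1]^d\to\mathbb R$, the $\ell_1$-multicalibration error is $$K(\pi_T,\mathcal H)=\sup_{h\in\mathcal H}\ \sum_{p\in\mathcal P}\frac1T\Big|\sum_{t\,:\,p_t=p}h(x_t)\,(y_t-p_t)\Big| .$$ Let $\mathcal H=\{x\mapsto\langle h,x\rangle : h\in\mathbb R^d,\ \|h\|_1\le B\}$ be the class of bounded linear functions. **Claim.** There are a single algorithm on a real RAM (unit-cost arithmetic and comparisons of reals; addition, subtraction and comparison of indices; indirect addressing), which gets $d$, $T$ and $B$ as input, and an absolute constant $C>0$ such that for all $d\ge1$, $T\ge1$ and $B>0$ with $BT\ge2$, the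 algorithm, with some discretization $m\ge1$ that it computes, has the following properties. 1. *Runtime.* Its set-up and each of its rounds (including reading the context and drawing the forecast) take at most $C\,(\max\{1,B\}\sqrt T)^d$ steps, that is, $O((B\sqrt T)^d)$ steps for $B\ge1$. If $d\ge3$, then the total over the set-up and all $T$ rounds is also at most $C\,(\max\{1,B\}\sqrt T)^d$. 2. *Error.* Against every adversary, $$\mathbb E\big[K(\pi_T,\mathcal H)\big]\ \le\ C\,B\,d^{1/2}\,T^{-1/3}\log(BT).$$ -/

import Mathlib

noncomputable section

namespace OnlineMC

/-! ### The online protocol and the multicalibration error -/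

/-- The context space `[0,1]^d`. -/
abbrev Context (d : ℕ) : Type := Fin d → unitInterval

/-- One round of interaction: the context `x_t`, the forecast `p_t = pred / m` in
`{0, 1/m, …, 1}`, and the label `y_t ∈ [0,1]`. -/
structure Round (d m : ℕ) where
  context : Context d
  pred : Fin (m + 1)
  label : unitInterval

/-- Transcripts and histories, in chronological order. -/
abbrev History (d m : ℕ) : Type := List (Round d m)

/-- `K(π, h) = ∑_{p} (1/T) |∑_{t : p_t = p} h(x_t) (y_t - p)|`, where `T` is the length of `π` and
`p` ranges over `{0, 1/m, …, 1}`. -/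
def calError {d m : ℕ} (π : History d m) (h : Context d → ℝ) : ℝ :=
  ∑ p : Fin (m + 1), (1 / (π.length : ℝ)) *
    |((π.filter (fun r => r.pred = p)).map
        (fun r => h r.context * ((r.label : ℝ) - (p : ℝ) / (m : ℝ)))).sum|

/-- `K(π, 𝓗)`, the supremum of `K(π, h)` over `h ∈ 𝓗`. -/
def multiCalError {d m : ℕ} (π : History d m) (H : Set (Context d → ℝ)) : ℝ :=
  sSup (calError π '' H)

/-- The linear functions `x ↦ ⟨h, x⟩` on `[0,1]^d` with `‖h‖₁ ≤ B`. -/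
def linearClass (d : ℕ) (B : ℝ) : Set (Context d → ℝ) :=
  {f | ∃ h : Fin d → ℝ, ∑ i, |h i| ≤ B ∧ f = fun x => ∑ i, h i * (x i : ℝ)}

/-- A learner: given the history and the current context it selects a probability distribution
`w_t` on the forecasts `{0, 1/m, …, 1}`. -/
abbrev Learner (d m : ℕ) : Type := History d m → Context d → stdSimplex ℝ (Fin (m + 1))

/-- An adaptive adversary: it selects the next context and label from the whole history, including
the realized forecasts, but before the next forecast is drawn. (A randomized adversary is a
mixture of these, so a bound that holds for all of these holds for it as well.) -/
abbrev Adversary (d m : ℕ) : Type := History d m → Context d × unitInterval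

/-- The expectation of `F` of the transcript when `n` further rounds are played after the history
`π`, each forecast being drawn from the distribution that the learner selects. -/
def expect {d m : ℕ} (L : Learner d m) (adv : Adversary d m) (F : History d m → ℝ) :
    ℕ → History d m → ℝ
  | 0, π => F π
  | n + 1, π => ∑ p : Fin (m + 1),
      (L π (adv π).1 : Fin (m + 1) → ℝ) p *
        expect L adv F n (π ++ [⟨(adv π).1, p, (adv π).2⟩])

/-! ### A real RAM

Index registers hold natural numbers, real registers hold real numbers, and there are arrays of
real numbers that are addressed through the index registers. Index registers can only be set to a
constant, added and subtracted; real registers can be added, subtracted, multiplied, divided.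
Each instruction and each test of a condition is one step. -/

/-- A memory state. A program mentions only finitely many registers and arrays. -/
structure State where
  idx : ℕ → ℕ
  acc : ℕ → ℝ
  arr : ℕ → ℕ → ℝ

inductive ArithOp where
  | add | sub | mul | div

def ArithOp.eval : ArithOp → ℝ → ℝ → ℝ
  | .add, a, b => a + b
  | .sub, a, b => a - b
  | .mul, a, b => a * b
  | .div, a, b => a / b

inductive Instr where
  /-- `idx i := c` -/
  | setIdx (i c : ℕ)
  /-- `idx i := idx j + idx k` -/
  | addIdx (i j k : ℕ)
  /-- `idx i := idx j - idx k` (truncated at zero) -/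
  | subIdx (i j k : ℕ)
  /-- `acc a := idx i` -/
  | cast (a i : ℕ)
  /-- `acc a := acc b ∘ acc c` for an arithmetic operation `∘` -/
  | arith (op : ArithOp) (a b c : ℕ)
  /-- `acc a := arr A [idx i]` -/
  | load (a A i : ℕ)
  /-- `arr A [idx i] := acc a` -/
  | store (A i a : ℕ)

def Instr.apply : Instr → State → State
  | .setIdx i c, s => { s with idx := Function.update s.idx i c }
  | .addIdx i j k, s => { s with idx := Function.update s.idx i (s.idx j + s.idx k) }
  | .subIdx i j k, s => { s with idx := Function.update s.idx i (s.idx j - s.idx k) }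
  | .cast a i, s => { s with acc := Function.update s.acc a (s.idx i : ℝ) }
  | .arith op a b c, s =>
      { s with acc := Function.update s.acc a (op.eval (s.acc b) (s.acc c)) }
  | .load a A i, s => { s with acc := Function.update s.acc a (s.arr A (s.idx i)) }
  | .store A i a, s =>
      { s with arr := Function.update s.arr A (Function.update (s.arr A) (s.idx i) (s.acc a)) }

inductive Test where
  /-- `idx i < idx j` -/
  | idxLt (i j : ℕ)
  /-- `acc a < acc b` -/
  | accLt (a b : ℕ)

def Test.Holds : Test → State → Prop
  | .idxLt i j, s => s.idx i < s.idx j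
  | .accLt a b, s => s.acc a < s.acc b

/-- Programs. -/
inductive Prog where
  | skip
  | instr (i : Instr)
  | seq (P Q : Prog)
  | ite (t : Test) (P Q : Prog)
  | loop (t : Test) (P : Prog)

/-- `Exec P s s' n`: started in `s`, the program `P` halts in `s'` after `n` steps. -/
inductive Exec : Prog → State → State → ℕ → Prop
  | skip (s : State) : Exec .skip s s 1
  | instr (i : Instr) (s : State) : Exec (.instr i) s (i.apply s) 1
  | seq {P Q : Prog} {s₁ s₂ s₃ : State} {n₁ n₂ : ℕ} :
      Exec P s₁ s₂ n₁ → Exec Q s₂ s₃ n₂ → Exec (.seq P Q) s₁ s₃ (n₁ + n₂)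
  | iteTrue {t : Test} {P Q : Prog} {s s' : State} {n : ℕ} :
      t.Holds s → Exec P s s' n → Exec (.ite t P Q) s s' (n + 1)
  | iteFalse {t : Test} {P Q : Prog} {s s' : State} {n : ℕ} :
      ¬ t.Holds s → Exec Q s s' n → Exec (.ite t P Q) s s' (n + 1)
  | loopDone {t : Test} {P : Prog} {s : State} :
      ¬ t.Holds s → Exec (.loop t P) s s 1
  | loopStep {t : Test} {P : Prog} {s₁ s₂ s₃ : State} {n₁ n₂ : ℕ} :
      t.Holds s₁ → Exec P s₁ s₂ n₁ → Exec (.loop t P) s₂ s₃ n₂ →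
        Exec (.loop t P) s₁ s₃ (n₁ + n₂ + 1)

/-! ### Online algorithms on the real RAM -/

/-- An online forecasting algorithm: `setup` is run once at the start; in each round, `predict` is
run after the context has arrived, and `update` after the forecast has been drawn and the label
has been revealed. The memory persists throughout. -/
structure Algorithm where
  setup : Prog
  predict : Prog
  update : Prog

/-- The initial state: the input is the dimension `d`, the horizon `T` and the norm bound `B`;
everything else is zero. -/
def initState (d T : ℕ) (B : ℝ) : State where
  idx := fun i => if i = 0 then d else if i = 1 then T else 0
  acc := fun a => if a = 0 then B else 0
  arr := fun _ _ => 0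

/-- The context arrives in array `0`. -/
def State.receiveContext {d : ℕ} (s : State) (x : Context d) : State :=
  { s with arr := Function.update s.arr 0 (fun k => if hk : k < d then (x ⟨k, hk⟩ : ℝ) else 0) }

/-- The index of the drawn forecast arrives in index register `3`, the label in real register
`1`. -/
def State.receiveOutcome (s : State) (p : ℕ) (y : ℝ) : State :=
  { s with idx := Function.update s.idx 3 p, acc := Function.update s.acc 1 y }

/-- On input `d`, `T`, `B`, the algorithm `A` carries out the learner `L` with forecasts
`{0, 1/m, …, 1}`, where the set-up and each of the `T` rounds take at most `τ` steps, whatever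
contexts and labels arrive and whatever forecasts are drawn. Here `σ π` is the state of the memory
after the history `π`. The set-up has to leave `m` in index register `2`, and `predict` has to
write the distribution into the entries `0, …, m` of array `1`. The steps of a round are those of
the two programs, `d` for reading the context and `m + 1` for drawing a forecast from the table of
its probabilities. -/
def Algorithm.Implements (A : Algorithm) (d T : ℕ) (B : ℝ) {m : ℕ} (L : Learner d m) (τ : ℕ) :
    Prop :=
  ∃ σ : History d m → State,
    (∃ n : ℕ, Exec A.setup (initState d T B) (σ []) n ∧ n ≤ τ ∧ (σ []).idx 2 = m) ∧
    ∀ π : History d m, π.length < T → ∀ x : Context d,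
      ∃ (s : State) (n₁ : ℕ), Exec A.predict ((σ π).receiveContext x) s n₁ ∧
        (∀ p : Fin (m + 1), s.arr 1 p = (L π x : Fin (m + 1) → ℝ) p) ∧
        ∀ (p : Fin (m + 1)) (y : unitInterval),
          ∃ n₂ : ℕ, Exec A.update (s.receiveOutcome p y) (σ (π ++ [⟨x, p, y⟩])) n₂ ∧
            d + n₁ + (m + 1) + n₂ ≤ τ

end OnlineMC

end

/-!
For every forecast `p` keep the vector `v p = ∑ (y_t - p) • x_t` over the rounds with `p_t = p`. By
Cauchy–Schwarz the error against the linear functions is at most `B / T * ∑ ‖v p‖`, and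
`2 * ‖v‖ ≤ ‖v‖ ^ 2 / s + s` for every scale `s > 0`. Whenever `v p` outgrows its scale `s p`,
replace `s p` by `‖v p‖ ^ 2 / s p`: this swaps the two summands, so that the potential
`Φ = ∑ (‖v p‖ ^ 2 / s p + s p)` does not change. A round with context `x` and label `y` then changes
`Φ` by `2 * (y - p) * f p + O(d / c)`, where `c` is the initial scale and `f p = ⟪v p, x⟫ / s p`
satisfies `|f p| ≤ √d`. If the forecast is one of two neighbouring grid points between which `f`
changes its sign, drawn such that `f p` has mean zero, the expectation of `(y - p) * f p` is at most
`√d / m`. With `m ≈ T ^ (1 / 3)` and `c ≈ m * √d` the expectation of `Φ` is `O(m ^ 2 * √d)` after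
`T` rounds, which is an error of `O(B * √d * T ^ (-1 / 3))`.

A round costs `O(m * d)` steps, and so does the set-up; the machine has no roots, so `m` and `c` are
found by linear search. For `X = max 1 B * √T` we have `m = O(X)`, `T ≤ X ^ 2` and `2 ≤ X ^ 2`,
whence `m * d = O(X ^ d)`, and `T * m * d = O(X ^ d)` if `d ≥ 3`.
-/

noncomputable section

namespace OnlineMC

section Accumulator

/-- A running sum of vectors together with the scale that normalizes its correlations. -/
structure Accumulator (E : Type*) where
  total : E
  scale : ℝ

variable {E : Type*} [NormedAddCommGroup E]

namespace Accumulator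

/-- Adds a vector to the sum and enlarges the scale if the sum has outgrown it. -/
def add (a : Accumulator E) (u : E) : Accumulator E where
  total := a.total + u
  scale := max a.scale (‖a.total + u‖ ^ 2 / a.scale)

/-- The part of the potential that a single running sum contributes. -/
def cost (a : Accumulator E) : ℝ := ‖a.total‖ ^ 2 / a.scale + a.scale

/-- The invariant that `add` maintains: the scale is at least `c` and dominates the sum. -/
structure Balanced (c : ℝ) (a : Accumulator E) : Prop where
  le_scale : c ≤ a.scale
  norm_total_le : ‖a.total‖ ≤ a.scale

theorem Balanced.add {c : ℝ} {a : Accumulator E} (hc : 0 < c) (h : a.Balanced c) (u : E) :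
    (a.add u).Balanced c where
  le_scale := h.le_scale.trans (le_max_left _ _)
  norm_total_le := by
    have hs : 0 < a.scale := hc.trans_le h.le_scale
    simp only [Accumulator.add, le_max_iff, le_div_iff₀ hs]
    refine (le_total ‖a.total + u‖ a.scale).imp_right fun hle => ?_
    rw [sq]
    gcongr

theorem two_mul_norm_total_le_cost {a : Accumulator E} (hs : 0 < a.scale) :
    2 * ‖a.total‖ ≤ a.cost := by
  have h := two_mul_le_add_sq ‖a.total‖ a.scale
  rw [cost, div_add' _ _ _ hs.ne', le_div_iff₀ hs]
  linarith

theorem total_foldl_add (l : List E) (a : Accumulator E) :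
    (l.foldl add a).total = a.total + l.sum := by
  induction l generalizing a with
  | nil => simp
  | cons u l ih => simp [ih, add, add_assoc]

theorem Balanced.foldl_add {c : ℝ} {a : Accumulator E} (hc : 0 < c) (h : a.Balanced c)
    (l : List E) : (l.foldl Accumulator.add a).Balanced c :=
  List.foldlRecOn l _ h fun _ hb u _ => hb.add hc u

end Accumulator

/-- The potential of the descent argument. -/
def potential {ι : Type*} [Fintype ι] (M : ι → Accumulator E) : ℝ := ∑ p, (M p).cost

theorem potential_update {ι : Type*} [Fintype ι] [DecidableEq ι] (M : ι → Accumulator E) (p : ι)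
    (a : Accumulator E) :
    potential (Function.update M p a) = potential M + (a.cost - (M p).cost) := by
  simp only [potential, Function.apply_update (fun _ => Accumulator.cost)]
  rw [Finset.sum_update_of_mem (Finset.mem_univ p),
    Finset.sum_eq_add_sum_sdiff_singleton_of_mem (Finset.mem_univ p) fun q => (M q).cost]
  ring

namespace Accumulator

variable [InnerProductSpace ℝ E]

/-- The normalized correlation of the running sum with a vector. -/
def correlation (a : Accumulator E) (x : E) : ℝ := inner ℝ a.total x / a.scale

theorem Balanced.abs_correlation_le {c : ℝ} {a : Accumulator E} (h : a.Balanced c) (x : E) :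
    |a.correlation x| ≤ ‖x‖ := by
  have hs : 0 ≤ a.scale := (norm_nonneg _).trans h.norm_total_le
  rw [correlation, abs_div, abs_of_nonneg hs]
  refine div_le_of_le_mul₀ hs (norm_nonneg _) ?_
  calc |inner ℝ a.total x| ≤ ‖a.total‖ * ‖x‖ := abs_real_inner_le_norm _ _
    _ ≤ ‖x‖ * a.scale := by
      rw [mul_comm]
      exact mul_le_mul_of_nonneg_left h.norm_total_le (norm_nonneg _)

/-- Enlarging the scale is free: replacing `s` by `‖v‖ ^ 2 / s` swaps the summands of the cost. -/
theorem cost_add {a : Accumulator E} (hs : 0 < a.scale) (u : E) :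
    (a.add u).cost = a.cost + 2 * a.correlation u + ‖u‖ ^ 2 / a.scale := by
  have rescale (q : ℝ) : q / max a.scale (q / a.scale) + max a.scale (q / a.scale) =
      q / a.scale + a.scale := by
    rcases le_total (q / a.scale) a.scale with hq | hq
    · rw [max_eq_left hq]
    · have : q ≠ 0 := by
        rintro rfl
        simp only [zero_div] at hq
        exact hs.not_ge hq
      rw [max_eq_right hq, div_div_cancel₀ this, add_comm]
  calc (a.add u).cost = ‖a.total + u‖ ^ 2 / a.scale + a.scale := rescale _
    _ = a.cost + 2 * a.correlation u + ‖u‖ ^ 2 / a.scale := by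
      rw [norm_add_sq_real, cost, correlation]
      ring

end Accumulator

end Accumulator

section Ledger

variable {E : Type*} [NormedAddCommGroup E] [NormedSpace ℝ E] {d m : ℕ}

/-- The signed error `y - p` of a round, multiplied by the feature vector of its context. -/
def residual (φ : Context d → E) (r : Round d m) : E :=
  ((r.label : ℝ) - (r.pred : ℝ) / m) • φ r.context

/-- For each forecast, the residuals of the rounds in which it was drawn, accumulated from the
initial scale `c`. -/
def ledger (φ : Context d → E) (c : ℝ) (π : History d m) : Fin (m + 1) → Accumulator E :=
  fun p => ((π.filter (fun r => r.pred = p)).map (residual φ)).foldl Accumulator.add ⟨0, c⟩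

theorem ledger_append_singleton (φ : Context d → E) (c : ℝ) (π : History d m) (r : Round d m) :
    ledger φ c (π ++ [r]) =
      Function.update (ledger φ c π) r.pred ((ledger φ c π r.pred).add (residual φ r)) := by
  funext p
  rcases eq_or_ne p r.pred with rfl | h
  · simp [ledger]
  · simp [ledger, h, h.symm]

theorem balanced_ledger {c : ℝ} (hc : 0 < c) (φ : Context d → E) (π : History d m)
    (p : Fin (m + 1)) : (ledger φ c π p).Balanced c :=
  Accumulator.Balanced.foldl_add hc ⟨le_rfl, by simpa using hc.le⟩ _

theorem scale_ledger_pos {c : ℝ} (hc : 0 < c) (φ : Context d → E) (π : History d m)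
    (p : Fin (m + 1)) : 0 < (ledger φ c π p).scale :=
  hc.trans_le (balanced_ledger hc φ π p).le_scale

theorem potential_ledger_nil (φ : Context d → E) (c : ℝ) :
    potential (ledger (m := m) φ c []) = (m + 1) * c := by
  simp [potential, ledger, Accumulator.cost]

theorem abs_label_sub_pred_le (r : Round d m) : |(r.label : ℝ) - (r.pred : ℝ) / m| ≤ 1 := by
  have hp : (r.pred : ℝ) / m ≤ 1 :=
    div_le_one_of_le₀ (mod_cast Nat.lt_succ_iff.mp r.pred.isLt) (Nat.cast_nonneg m)
  have hp' : 0 ≤ (r.pred : ℝ) / m := by positivity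
  rw [abs_le]
  constructor <;> linarith [r.label.2.1, r.label.2.2]

theorem norm_residual_le (φ : Context d → E) (r : Round d m) : ‖residual φ r‖ ≤ ‖φ r.context‖ := by
  rw [residual, norm_smul, Real.norm_eq_abs]
  exact mul_le_of_le_one_left (norm_nonneg _) (abs_label_sub_pred_le r)

end Ledger

section Crossing

variable {m : ℕ}

open Classical in
/-- The largest `p + 1 ≤ k` with `0 < f p`, or `0` if there is none. -/
def lastPos (f : Fin (m + 1) → ℝ) (k : ℕ) : ℕ :=
  Nat.findGreatest (fun j => ∃ p : Fin (m + 1), (p : ℕ) + 1 = j ∧ 0 < f p) k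

theorem lastPos_zero (f : Fin (m + 1) → ℝ) : lastPos f 0 = 0 := Nat.findGreatest_zero

theorem lastPos_add_one (f : Fin (m + 1) → ℝ) (p : Fin (m + 1)) :
    lastPos f (p + 1) = if 0 < f p then (p : ℕ) + 1 else lastPos f p := by
  have hp : (∃ q : Fin (m + 1), (q : ℕ) + 1 = p + 1 ∧ 0 < f q) ↔ 0 < f p :=
    ⟨fun ⟨q, hq, h⟩ => by rwa [← Fin.ext (Nat.succ_injective hq)], fun h => ⟨p, rfl, h⟩⟩
  simp only [lastPos, Nat.findGreatest_succ, hp]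

/-- The position of the last positive value of `f`, counted from `1`, or `0` if there is none. -/
def crossing (f : Fin (m + 1) → ℝ) : ℕ := lastPos f (m + 1)

theorem crossing_le (f : Fin (m + 1) → ℝ) : crossing f ≤ m + 1 := Nat.findGreatest_le _

/-- The left neighbour of the crossing, clipped to `{0, …, m}` by the truncated subtraction. -/
def lower (f : Fin (m + 1) → ℝ) : Fin (m + 1) :=
  ⟨crossing f - 1, by have := crossing_le f; omega⟩

/-- The right neighbour of the crossing, clipped to `{0, …, m}`. -/
def upper (f : Fin (m + 1) → ℝ) : Fin (m + 1) := ⟨min (crossing f) m, by omega⟩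

theorem lt_crossing_of_pos {f : Fin (m + 1) → ℝ} {p : Fin (m + 1)} (hp : 0 < f p) :
    (p : ℕ) < crossing f :=
  Nat.le_findGreatest p.isLt ⟨p, rfl, hp⟩

theorem pos_of_crossing_eq_add_one {f : Fin (m + 1) → ℝ} {p : Fin (m + 1)}
    (h : crossing f = p + 1) : 0 < f p := by
  classical
  obtain ⟨q, hq, hpos⟩ := Nat.findGreatest_of_ne_zero h p.val.succ_ne_zero
  rwa [Fin.ext (Nat.succ_injective hq)] at hpos

theorem lower_upper_cases (f : Fin (m + 1) → ℝ) :
    (lower f = 0 ∧ upper f = 0 ∧ f 0 ≤ 0) ∨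
      (lower f = Fin.last m ∧ upper f = Fin.last m ∧ 0 < f (Fin.last m)) ∨
      ((lower f : ℕ) + 1 = upper f ∧ 0 < f (lower f) ∧ f (upper f) ≤ 0) := by
  rcases Nat.eq_zero_or_pos (crossing f) with h0 | hpos
  · refine .inl ⟨Fin.ext ?_, Fin.ext ?_, not_lt.1 fun hp => ?_⟩
    · simp [lower, h0]
    · simp [upper, h0]
    · simpa [h0] using lt_crossing_of_pos hp
  rcases (crossing_le f).eq_or_lt with h | h
  · refine .inr (.inl ⟨Fin.ext ?_, Fin.ext ?_, pos_of_crossing_eq_add_one h⟩)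
    · simp [lower, h]
    · simp [upper, h]
  · have hu : (upper f : ℕ) = crossing f := min_eq_left (Nat.lt_succ_iff.1 h)
    have hl : (lower f : ℕ) + 1 = crossing f := Nat.sub_add_cancel hpos
    refine .inr (.inr ⟨hl.trans hu.symm, pos_of_crossing_eq_add_one hl.symm, not_lt.1 fun hp => ?_⟩)
    exact hu.not_lt (lt_crossing_of_pos hp)

/-- The probability of the right neighbour that makes the expectation of `f` vanish if `f` changes
its sign at the crossing. -/
def mixing (f : Fin (m + 1) → ℝ) : ℝ :=
  if lower f < upper f then f (lower f) / (f (lower f) - f (upper f)) else 0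

theorem mixing_mem_Icc (f : Fin (m + 1) → ℝ) : mixing f ∈ Set.Icc (0 : ℝ) 1 := by
  unfold mixing
  split_ifs with h
  · rcases lower_upper_cases f with ⟨hl, hu, _⟩ | ⟨hl, hu, _⟩ | ⟨_, hl, hu⟩
    · simp [hl, hu] at h
    · simp [hl, hu] at h
    · have : 0 < f (lower f) - f (upper f) := by linarith
      exact ⟨by positivity, (div_le_one this).2 (by linarith)⟩
  · simp

/-- The distribution on the two neighbours of the crossing. -/
def weights (f : Fin (m + 1) → ℝ) : stdSimplex ℝ (Fin (m + 1)) :=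
  ⟨(1 - mixing f) • Pi.single (lower f) 1 + mixing f • Pi.single (upper f) 1,
    convex_stdSimplex ℝ _ (single_mem_stdSimplex ℝ _) (single_mem_stdSimplex ℝ _)
      (sub_nonneg.2 (mixing_mem_Icc f).2) (mixing_mem_Icc f).1 (sub_add_cancel _ _)⟩

theorem weights_apply (f : Fin (m + 1) → ℝ) (p : Fin (m + 1)) :
    weights f p = (1 - mixing f) * (Pi.single (lower f) 1 : Fin (m + 1) → ℝ) p +
      mixing f * (Pi.single (upper f) 1 : Fin (m + 1) → ℝ) p :=
  rfl

theorem sum_weights_mul (f g : Fin (m + 1) → ℝ) :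
    ∑ p, weights f p * g p =
      (1 - mixing f) * g (lower f) + mixing f * g (upper f) := by
  simp [weights_apply, add_mul, Finset.sum_add_distrib, Pi.single_apply]

theorem sum_weights_mul_sub_mul_le (hm : 1 ≤ m) {f : Fin (m + 1) → ℝ} {r : ℝ}
    (hf : ∀ p, |f p| ≤ r) {y : ℝ} (hy : y ∈ unitInterval) :
    ∑ p, weights f p * ((y - (p : ℝ) / m) * f p) ≤ r / m := by
  have hr : 0 ≤ r := (abs_nonneg _).trans (hf 0)
  have hm0 : (m : ℝ) ≠ 0 := Nat.cast_ne_zero.2 (by omega)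
  rw [sum_weights_mul f (fun p => (y - (p : ℝ) / m) * f p)]
  rcases lower_upper_cases f with ⟨hl, hu, h0⟩ | ⟨hl, hu, hlast⟩ | ⟨hlu, hl, hu⟩
  · calc _ = y * f 0 := by simp [hl, hu, mixing]
      _ ≤ 0 := mul_nonpos_of_nonneg_of_nonpos hy.1 h0
      _ ≤ r / m := by positivity
  · calc _ = (y - 1) * f (Fin.last m) := by simp [hl, hu, mixing, hm0]
      _ ≤ 0 := mul_nonpos_of_nonpos_of_nonneg (sub_nonpos.2 hy.2) hlast.le
      _ ≤ r / m := by positivity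
  · have mean_eq_zero : (1 - mixing f) * f (lower f) + mixing f * f (upper f) = 0 := by
      rw [mixing, if_pos (by omega)]
      field_simp [(by linarith : f (lower f) - f (upper f) ≠ 0)]
      ring
    have hcast : ((upper f : ℕ) : ℝ) = (lower f : ℕ) + 1 := by rw [← hlu]; push_cast; rfl
    calc _ = (y - (lower f : ℕ) / m) *
            ((1 - mixing f) * f (lower f) + mixing f * f (upper f)) +
          mixing f * -f (upper f) / m := by rw [hcast]; ring
      _ = mixing f * -f (upper f) / m := by rw [mean_eq_zero, mul_zero, zero_add]
      _ ≤ r / m := by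
        gcongr
        exact (mul_le_of_le_one_left (neg_nonneg.2 hu) (mixing_mem_Icc f).2).trans
          ((neg_le_abs _).trans (hf _))

end Crossing

section Expect

theorem sum_stdSimplex_mul_add {ι : Type*} [Fintype ι] (w : stdSimplex ℝ ι) (g : ι → ℝ) (a : ℝ) :
    ∑ p, w p * (g p + a) = ∑ p, w p * g p + a := by
  simp only [mul_add, Finset.sum_add_distrib, ← Finset.sum_mul, stdSimplex.sum_eq_one, one_mul]

variable {d m : ℕ} {L : Learner d m} {adv : Adversary d m} {F V : History d m → ℝ}

theorem expect_mono {G : History d m → ℝ} {n : ℕ} {π : History d m}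
    (h : ∀ π' : History d m, π'.length = π.length + n → F π' ≤ G π') :
    expect L adv F n π ≤ expect L adv G n π := by
  induction n generalizing π with
  | zero => exact h π rfl
  | succ n ih =>
    refine Finset.sum_le_sum fun p _ => mul_le_mul_of_nonneg_left (ih fun π' hπ' => h π' ?_)
      (stdSimplex.zero_le _ p)
    simp only [hπ', List.length_append, List.length_singleton]
    omega

theorem expect_le_add_mul_of_drift {δ : ℝ}
    (h : ∀ (π : History d m) (x : Context d) (y : unitInterval),
      ∑ p, L π x p * V (π ++ [⟨x, p, y⟩]) ≤ V π + δ) (n : ℕ)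
    (π : History d m) : expect L adv V n π ≤ V π + n * δ := by
  induction n generalizing π with
  | zero => simp [expect]
  | succ n ih =>
    set x := (adv π).1
    set y := (adv π).2
    calc expect L adv V (n + 1) π
        ≤ ∑ p, L π x p * (V (π ++ [⟨x, p, y⟩]) + n * δ) :=
          Finset.sum_le_sum fun p _ => mul_le_mul_of_nonneg_left (ih _) (stdSimplex.zero_le _ p)
      _ = ∑ p, L π x p * V (π ++ [⟨x, p, y⟩]) + n * δ := sum_stdSimplex_mul_add _ _ _
      _ ≤ V π + (n + 1 : ℕ) * δ := by
          push_cast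
          linarith [h π x y]

theorem expect_const_mul (a : ℝ) (n : ℕ) (π : History d m) :
    expect L adv (fun π => a * F π) n π = a * expect L adv F n π := by
  induction n generalizing π with
  | zero => rfl
  | succ n ih => simp only [expect, ih, Finset.mul_sum, mul_left_comm]

end Expect

section Forecaster

variable {E : Type*} [NormedAddCommGroup E] [InnerProductSpace ℝ E] {d m : ℕ}

/-- The learner that randomizes around a sign change of the correlations of the current feature
vector with the ledger. -/
def forecaster (φ : Context d → E) (c : ℝ) : Learner d m :=
  fun π x => weights fun p => (ledger φ c π p).correlation (φ x)

theorem potential_ledger_append {c : ℝ} (hc : 0 < c) (φ : Context d → E) (π : History d m)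
    (r : Round d m) :
    potential (ledger φ c (π ++ [r])) = potential (ledger φ c π) +
      (2 * ((r.label : ℝ) - (r.pred : ℝ) / m) * (ledger φ c π r.pred).correlation (φ r.context) +
        ‖residual φ r‖ ^ 2 / (ledger φ c π r.pred).scale) := by
  rw [ledger_append_singleton, potential_update, Accumulator.cost_add (scale_ledger_pos hc φ π _)]
  simp only [Accumulator.correlation, residual, real_inner_smul_right]
  ring

theorem potential_ledger_append_le {c r : ℝ} (hc : 0 < c) {φ : Context d → E}
    (hφ : ∀ x, ‖φ x‖ ≤ r) (π : History d m) (x : Context d) (p : Fin (m + 1)) (y : unitInterval) :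
    potential (ledger φ c (π ++ [⟨x, p, y⟩])) ≤
      2 * (((y : ℝ) - (p : ℝ) / m) * (ledger φ c π p).correlation (φ x)) +
        (potential (ledger φ c π) + r ^ 2 / c) := by
  have hsq : ‖residual φ (⟨x, p, y⟩ : Round d m)‖ ^ 2 / (ledger φ c π p).scale ≤ r ^ 2 / c := by
    gcongr
    · exact (norm_residual_le φ _).trans (hφ x)
    · exact (balanced_ledger hc φ π p).le_scale
  rw [potential_ledger_append hc]
  linarith

theorem sum_forecaster_mul_potential_le (hm : 1 ≤ m) {c r : ℝ} (hc : 0 < c) {φ : Context d → E}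
    (hφ : ∀ x, ‖φ x‖ ≤ r) (π : History d m) (x : Context d) (y : unitInterval) :
    ∑ p, forecaster φ c π x p * potential (ledger φ c (π ++ [⟨x, p, y⟩])) ≤
      potential (ledger φ c π) + (2 * (r / m) + r ^ 2 / c) := by
  have hcorr (p : Fin (m + 1)) : |(ledger φ c π p).correlation (φ x)| ≤ r :=
    ((balanced_ledger hc φ π p).abs_correlation_le _).trans (hφ x)
  calc ∑ p, forecaster φ c π x p * potential (ledger φ c (π ++ [⟨x, p, y⟩]))
      ≤ ∑ p, forecaster φ c π x p *
          (2 * (((y : ℝ) - (p : ℝ) / m) * (ledger φ c π p).correlation (φ x)) +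
            (potential (ledger φ c π) + r ^ 2 / c)) := by
        gcongr with p
        · exact stdSimplex.zero_le _ p
        · exact potential_ledger_append_le hc hφ π x p y
    _ = 2 * ∑ p, forecaster φ c π x p *
            (((y : ℝ) - (p : ℝ) / m) * (ledger φ c π p).correlation (φ x)) +
          (potential (ledger φ c π) + r ^ 2 / c) := by
        simp only [sum_stdSimplex_mul_add, mul_left_comm _ (2 : ℝ), ← Finset.mul_sum]
    _ ≤ potential (ledger φ c π) + (2 * (r / m) + r ^ 2 / c) := by
        have h : ∑ p, forecaster φ c π x p *
            (((y : ℝ) - (p : ℝ) / m) * (ledger φ c π p).correlation (φ x)) ≤ r / m :=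
          sum_weights_mul_sub_mul_le hm hcorr y.2
        linarith

/-- The functions on contexts that are linear in the features, with coefficients in a ball. -/
def innerClass (φ : Context d → E) (B : ℝ) : Set (Context d → ℝ) :=
  {f | ∃ h : E, ‖h‖ ≤ B ∧ f = fun x => inner ℝ h (φ x)}

theorem sum_map_mul_residual (φ : Context d → E) (c : ℝ) (h : E) (π : History d m)
    (p : Fin (m + 1)) :
    ((π.filter (fun r => r.pred = p)).map
        (fun r => inner ℝ h (φ r.context) * ((r.label : ℝ) - (p : ℝ) / (m : ℝ)))).sum =
      inner ℝ h (ledger φ c π p).total := by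
  rw [ledger, Accumulator.total_foldl_add, zero_add, ← innerₗ_apply_apply, map_list_sum,
    List.map_map]
  refine congrArg List.sum (List.map_congr_left fun r hr => ?_)
  obtain rfl : r.pred = p := by simpa using (List.mem_filter.1 hr).2
  simp [residual, mul_comm]

theorem calError_inner_le {B c : ℝ} (hc : 0 < c) (φ : Context d → E) {h : E} (hh : ‖h‖ ≤ B)
    (π : History d m) :
    calError π (fun x => inner ℝ h (φ x)) ≤ B / (2 * π.length) * potential (ledger φ c π) := by
  have hB : 0 ≤ B := (norm_nonneg h).trans hh
  simp only [calError, sum_map_mul_residual φ c, potential, Finset.mul_sum]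
  refine Finset.sum_le_sum fun p _ => ?_
  calc 1 / (π.length : ℝ) * |inner ℝ h (ledger φ c π p).total|
      ≤ 1 / π.length * (B * ((ledger φ c π p).cost / 2)) := by
        gcongr
        refine (abs_real_inner_le_norm _ _).trans (mul_le_mul hh ?_ (norm_nonneg _) hB)
        linarith [Accumulator.two_mul_norm_total_le_cost (scale_ledger_pos hc φ π p)]
    _ = B / (2 * π.length) * (ledger φ c π p).cost := by ring

theorem multiCalError_le_mul_potential {B c : ℝ} (hB : 0 ≤ B) (hc : 0 < c) {φ : Context d → E}
    {H : Set (Context d → ℝ)} (hH : H ⊆ innerClass φ B) (π : History d m) :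
    multiCalError π H ≤ B / (2 * π.length) * potential (ledger φ c π) := by
  refine Real.sSup_le ?_ (mul_nonneg (by positivity) (Finset.sum_nonneg fun p _ => ?_))
  · rintro _ ⟨f, hf, rfl⟩
    obtain ⟨h, hh, rfl⟩ := hH hf
    exact calError_inner_le hc φ hh π
  · exact (by positivity : 0 ≤ 2 * ‖_‖).trans
      (Accumulator.two_mul_norm_total_le_cost (scale_ledger_pos hc φ π p))

theorem expect_multiCalError_forecaster_le (hm : 1 ≤ m) {B c r : ℝ} (hB : 0 ≤ B) (hc : 0 < c)
    {φ : Context d → E} (hφ : ∀ x, ‖φ x‖ ≤ r) {H : Set (Context d → ℝ)}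
    (hH : H ⊆ innerClass φ B) (adv : Adversary d m) (T : ℕ) :
    expect (forecaster φ c) adv (fun π => multiCalError π H) T [] ≤
      B / (2 * T) * ((m + 1) * c + T * (2 * (r / m) + r ^ 2 / c)) := by
  calc expect (forecaster φ c) adv (fun π => multiCalError π H) T []
      ≤ expect (forecaster φ c) adv (fun π => B / (2 * T) * potential (ledger φ c π)) T [] :=
        expect_mono fun π hπ => by
          simpa [hπ] using multiCalError_le_mul_potential hB hc hH π
    _ = B / (2 * T) * expect (forecaster φ c) adv (fun π => potential (ledger φ c π)) T [] :=
        expect_const_mul _ _ _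
    _ ≤ B / (2 * T) * ((m + 1) * c + T * (2 * (r / m) + r ^ 2 / c)) := by
        rw [← potential_ledger_nil φ c]
        gcongr
        exact expect_le_add_mul_of_drift (sum_forecaster_mul_potential_le hm hc hφ) T []

end Forecaster

section Linear

variable {d : ℕ}

/-- A context as a vector of Euclidean space. -/
def coords (x : Context d) : EuclideanSpace ℝ (Fin d) := WithLp.toLp 2 fun i => (x i : ℝ)

theorem norm_coords_le (x : Context d) : ‖coords x‖ ≤ √d := by
  rw [EuclideanSpace.norm_eq]
  refine Real.sqrt_le_sqrt ?_
  calc ∑ i, ‖coords x i‖ ^ 2 ≤ ∑ _i : Fin d, (1 : ℝ) :=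
        Finset.sum_le_sum fun i _ => by
          simp [coords, abs_of_nonneg (x i).2.1, pow_le_one₀ (x i).2.1 (x i).2.2]
    _ = d := by simp

theorem norm_toLp_two_le_sum_abs (h : Fin d → ℝ) : ‖WithLp.toLp 2 h‖ ≤ ∑ i, |h i| := by
  refine le_of_sq_le_sq ?_ (Finset.sum_nonneg fun i _ => abs_nonneg _)
  rw [EuclideanSpace.real_norm_sq_eq]
  simpa only [sq_abs] using
    Finset.sum_sq_le_sq_sum_of_nonneg (s := Finset.univ) fun i _ => abs_nonneg (h i)

theorem linearClass_subset_innerClass (d : ℕ) (B : ℝ) :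
    linearClass d B ⊆ innerClass (coords (d := d)) B := by
  rintro _ ⟨h, hh, rfl⟩
  refine ⟨WithLp.toLp 2 h, (norm_toLp_two_le_sum_abs h).trans hh, ?_⟩
  simp [coords, PiLp.inner_apply, mul_comm]

end Linear

section CeilRoot

/-- The `j`-th root of `N`, rounded up. -/
def ceilRoot (j N : ℕ) : ℕ := ⌈(N : ℝ) ^ (j⁻¹ : ℝ)⌉₊

variable {j N : ℕ}

theorem lt_ceilRoot_iff (hj : 0 < j) {k : ℕ} : k < ceilRoot j N ↔ k ^ j < N := by
  rw [ceilRoot, Nat.lt_ceil,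
    Real.lt_rpow_inv_iff_of_pos k.cast_nonneg N.cast_nonneg (Nat.cast_pos.2 hj), Real.rpow_natCast]
  exact_mod_cast Iff.rfl

theorem ceilRoot_pos (hj : 0 < j) (hN : 0 < N) : 0 < ceilRoot j N := by
  simpa [lt_ceilRoot_iff hj, hj.ne'] using hN

theorem rpow_inv_le_ceilRoot (j N : ℕ) : (N : ℝ) ^ (j⁻¹ : ℝ) ≤ ceilRoot j N := Nat.le_ceil _

theorem ceilRoot_le_two_mul_rpow_inv (j : ℕ) (hN : 1 ≤ N) :
    (ceilRoot j N : ℝ) ≤ 2 * (N : ℝ) ^ (j⁻¹ : ℝ) := by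
  refine Nat.ceil_le_two_mul ?_
  linarith [Real.one_le_rpow (Nat.one_le_cast.2 hN) (by positivity : (0 : ℝ) ≤ (j⁻¹ : ℝ))]

theorem ceilRoot_le_self (hj : 0 < j) : ceilRoot j N ≤ N :=
  not_lt.1 fun h => ((lt_ceilRoot_iff hj).1 h).not_ge (Nat.le_self_pow hj.ne' N)

end CeilRoot

section Bounds

/-- The number of cells of the grid of forecasts. -/
def mesh (T : ℕ) : ℕ := ceilRoot 3 T

/-- The initial scale of the forecaster. -/
def initScale (d T : ℕ) : ℝ := mesh T * ceilRoot 2 d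

/-- A bound on the number of steps of the set-up and of every round. -/
def stepBound (d T : ℕ) : ℕ := 32 * (mesh T + 1) * (d + 1)

theorem error_bound_le {d T : ℕ} (hd : 1 ≤ d) (hT : 1 ≤ T) {B : ℝ} (hB : 0 ≤ B) :
    B / (2 * T) * ((mesh T + 1) * initScale d T +
        T * (2 * (√d / mesh T) + √d ^ 2 / initScale d T)) ≤
      10 * (B * √d * (T : ℝ) ^ (-(1 / 3) : ℝ)) := by
  obtain ⟨a, ha⟩ : ∃ a : ℝ, a = (T : ℝ) ^ ((3 : ℕ)⁻¹ : ℝ) := ⟨_, rfl⟩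
  obtain ⟨r, hr⟩ : ∃ r : ℝ, r = (d : ℝ) ^ ((2 : ℕ)⁻¹ : ℝ) := ⟨_, rfl⟩
  have hTa : (T : ℝ) = a ^ 3 := by rw [ha, Real.rpow_inv_natCast_pow T.cast_nonneg (by norm_num)]
  have hrd : √(d : ℝ) = r := by rw [hr, Real.sqrt_eq_rpow]; norm_num
  have hTinv : (T : ℝ) ^ (-(1 / 3) : ℝ) = a⁻¹ := by
    rw [Real.rpow_neg T.cast_nonneg, ha]
    norm_num
  have a_pos : 0 < a := by rw [ha]; positivity
  have r_pos : 0 < r := by rw [hr]; positivity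
  have a_le : a ≤ mesh T := ha ▸ rpow_inv_le_ceilRoot 3 T
  have le_a : (mesh T : ℝ) ≤ 2 * a := ha ▸ ceilRoot_le_two_mul_rpow_inv 3 hT
  have r_le : r ≤ ceilRoot 2 d := hr ▸ rpow_inv_le_ceilRoot 2 d
  have le_r : (ceilRoot 2 d : ℝ) ≤ 2 * r := hr ▸ ceilRoot_le_two_mul_rpow_inv 2 hd
  have one_le : (1 : ℝ) ≤ mesh T := mod_cast ceilRoot_pos three_pos hT
  have hstart : (mesh T + 1) * initScale d T ≤ 16 * a ^ 2 * r :=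
    calc (mesh T + 1) * (mesh T * ceilRoot 2 d : ℝ)
        ≤ (2 * a + 2 * a) * (2 * a * (2 * r)) := by gcongr; exact one_le.trans le_a
      _ = 16 * a ^ 2 * r := by ring
  have hround : 2 * (r / mesh T) + r ^ 2 / initScale d T ≤ 3 * (r / a) :=
    calc 2 * (r / mesh T) + r ^ 2 / (mesh T * ceilRoot 2 d)
        ≤ 2 * (r / a) + r ^ 2 / (a * r) := by gcongr
      _ = 3 * (r / a) := by field_simp; ring
  rw [hrd, hTinv, hTa]
  calc B / (2 * a ^ 3) * ((mesh T + 1) * initScale d T +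
        a ^ 3 * (2 * (r / mesh T) + r ^ 2 / initScale d T))
      ≤ B / (2 * a ^ 3) * (16 * a ^ 2 * r + a ^ 3 * (3 * (r / a))) := by gcongr
    _ = 19 / 2 * (B * r * a⁻¹) := by field_simp; ring
    _ ≤ 10 * (B * r * a⁻¹) := by gcongr; norm_num

variable {d T : ℕ} {X : ℝ}

theorem stepBound_le (hX : 2 ≤ X ^ 2) (hX0 : 0 ≤ X) (hT : (T : ℝ) ≤ X ^ 2) (hT1 : 1 ≤ T)
    {e : ℕ} (he : d ≤ e + 3) :
    (stepBound d T : ℝ) ≤ 384 * X ^ (e + 1) := by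
  have five_quarters_le : 5 / 4 ≤ X := by nlinarith
  have mesh_le : (mesh T : ℝ) ≤ 2 * X := by
    refine (ceilRoot_le_two_mul_rpow_inv 3 hT1).trans ?_
    gcongr
    calc (T : ℝ) ^ ((3 : ℕ)⁻¹ : ℝ) ≤ (T : ℝ) ^ (2⁻¹ : ℝ) :=
          Real.rpow_le_rpow_of_exponent_le (mod_cast hT1) (by norm_num)
      _ = √T := by rw [Real.sqrt_eq_rpow]; norm_num
      _ ≤ X := Real.sqrt_le_iff.2 ⟨hX0, hT⟩
  have dim_le : (d : ℝ) + 1 ≤ 4 * X ^ e := by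
    have := one_add_mul_sub_le_pow (by linarith : -1 ≤ X) e
    have : (d : ℝ) ≤ e + 3 := mod_cast he
    nlinarith
  calc (stepBound d T : ℝ) = 32 * (mesh T + 1) * (d + 1) := by simp [stepBound]
    _ ≤ 32 * (2 * X + X) * (4 * X ^ e) := by gcongr; linarith
    _ = 384 * X ^ (e + 1) := by ring

theorem stepBound_le_pow (hX : 2 ≤ X ^ 2) (hX0 : 0 ≤ X) (hT : (T : ℝ) ≤ X ^ 2) (hT1 : 1 ≤ T)
    (hd : 1 ≤ d) : (stepBound d T : ℝ) ≤ 768 * X ^ d := by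
  have h := stepBound_le hX hX0 hT hT1 (by omega : d ≤ d - 1 + 3)
  rw [Nat.sub_add_cancel hd] at h
  exact h.trans (by gcongr; norm_num)

theorem add_one_mul_stepBound_le_pow (hX : 2 ≤ X ^ 2) (hX0 : 0 ≤ X) (hT : (T : ℝ) ≤ X ^ 2)
    (hT1 : 1 ≤ T) (hd : 3 ≤ d) : ((T : ℝ) + 1) * stepBound d T ≤ 768 * X ^ d := by
  obtain ⟨e, rfl⟩ := Nat.exists_eq_add_of_le' hd
  calc ((T : ℝ) + 1) * stepBound (e + 3) T ≤ (X ^ 2 + X ^ 2) * (384 * X ^ (e + 1)) := by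
        gcongr
        · linarith
        · exact stepBound_le hX hX0 hT hT1 le_rfl
    _ = 768 * X ^ (e + 3) := by ring

theorem max_one_mul_le_sq (B : ℝ) (T : ℕ) : max 1 B * T ≤ (max 1 B * √T) ^ 2 := by
  rw [mul_pow, Real.sq_sqrt T.cast_nonneg]
  gcongr
  exact le_self_pow₀ (le_max_left 1 B) two_ne_zero

theorem ten_mul_le_mul_log {a x : ℝ} (ha : 0 ≤ a) (hx : 2 ≤ x) :
    10 * a ≤ 768 * (a * Real.log x) := by
  have : 1 / 2 ≤ Real.log x := by
    linarith [Real.log_two_gt_d9, Real.log_le_log two_pos hx]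
  nlinarith

end Bounds

/-! ### Execution of programs -/

/-- A part of the memory that an instruction can write to: a register or a whole array. -/
inductive Cell where
  | idx (i : ℕ)
  | acc (a : ℕ)
  | arr (A : ℕ)
  deriving DecidableEq

/-- The part of the memory that an instruction writes to. -/
def Instr.target : Instr → Cell
  | .setIdx i _ | .addIdx i _ _ | .subIdx i _ _ => .idx i
  | .cast a _ | .arith _ a _ _ | .load a _ _ => .acc a
  | .store A _ _ => .arr A

/-- Whether some instruction of a program writes to the given part of the memory. -/
def Prog.writes : Prog → Cell → Bool
  | .skip, _ => false
  | .instr i, c => i.target = c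
  | .seq P Q, c | .ite _ P Q, c => P.writes c || Q.writes c
  | .loop _ P, c => P.writes c

/-- The memory states `s` and `s'` agree on everything that `P` does not write to. -/
structure Frame (P : Prog) (s s' : State) : Prop where
  idx : ∀ {i}, P.writes (.idx i) = false → s'.idx i = s.idx i
  acc : ∀ {a}, P.writes (.acc a) = false → s'.acc a = s.acc a
  arr : ∀ {A}, P.writes (.arr A) = false → s'.arr A = s.arr A

namespace Frame

variable {P P' : Prog} {s s' s'' : State}

theorem refl (P : Prog) (s : State) : Frame P s s := ⟨fun _ => rfl, fun _ => rfl, fun _ => rfl⟩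

theorem trans (h : Frame P s s') (h' : Frame P s' s'') : Frame P s s'' :=
  ⟨fun hi => (h'.idx hi).trans (h.idx hi), fun ha => (h'.acc ha).trans (h.acc ha),
    fun hA => (h'.arr hA).trans (h.arr hA)⟩

theorem mono (h : Frame P s s') (hP : ∀ c, P'.writes c = false → P.writes c = false) :
    Frame P' s s' :=
  ⟨fun hi => h.idx (hP _ hi), fun ha => h.acc (hP _ ha), fun hA => h.arr (hP _ hA)⟩

theorem apply (i : Instr) (s : State) : Frame (.instr i) s (i.apply s) := by
  constructor <;> intro c hc <;> cases i <;>
    simp_all [Prog.writes, Instr.target, Instr.apply, Function.update_of_ne, eq_comm]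

theorem of_exec {n : ℕ} (h : Exec P s s' n) : Frame P s s' := by
  have left_of_or {b b'} (h : (b || b') = false) : b = false := (Bool.or_eq_false_iff.1 h).1
  have right_of_or {b b'} (h : (b || b') = false) : b' = false := (Bool.or_eq_false_iff.1 h).2
  induction h with
  | skip s => exact refl _ s
  | instr i s => exact apply i s
  | seq _ _ ih ih' => exact .trans (ih.mono fun _ => left_of_or) (ih'.mono fun _ => right_of_or)
  | iteTrue _ _ ih => exact ih.mono fun _ => left_of_or
  | iteFalse _ _ ih => exact ih.mono fun _ => right_of_or
  | loopDone => exact refl _ _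
  | loopStep _ _ _ ih ih' => exact .trans (ih.mono fun _ => id) ih'

end Frame

section Runs

/-- Started in `s`, the program `P` halts within `n` steps in a state that satisfies `Q`. -/
def Runs (P : Prog) (s : State) (Q : State → Prop) (n : ℕ) : Prop :=
  ∃ (s' : State) (k : ℕ), Exec P s s' k ∧ k ≤ n ∧ Q s'

variable {P P' : Prog} {s : State} {Q R : State → Prop} {n n' : ℕ}

theorem Runs.mono (h : Runs P s R n) (hQ : ∀ s', R s' → Q s') (hn : n ≤ n') : Runs P s Q n' := by
  obtain ⟨s', k, he, hk, hs⟩ := h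
  exact ⟨s', k, he, hk.trans hn, hQ _ hs⟩

theorem Runs.frame (h : Runs P s Q n) : Runs P s (fun s' => Q s' ∧ Frame P s s') n := by
  obtain ⟨s', k, he, hk, hs⟩ := h
  exact ⟨s', k, he, hk, hs, .of_exec he⟩

theorem Runs.seq (h : Runs P s R n) (h' : ∀ s', R s' → Runs P' s' Q n') :
    Runs (.seq P P') s Q (n + n') := by
  obtain ⟨s', k, he, hk, hs⟩ := h
  obtain ⟨s'', k', he', hk', hs'⟩ := h' s' hs
  exact ⟨s'', k + k', .seq he he', Nat.add_le_add hk hk', hs'⟩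

theorem Runs.ite {t : Test} (h : t.Holds s → Runs P s Q n) (h' : ¬ t.Holds s → Runs P' s Q n) :
    Runs (.ite t P P') s Q (n + 1) := by
  by_cases ht : t.Holds s
  · obtain ⟨s', k, he, hk, hs⟩ := h ht
    exact ⟨s', k + 1, .iteTrue ht he, Nat.add_le_add_right hk 1, hs⟩
  · obtain ⟨s', k, he, hk, hs⟩ := h' ht
    exact ⟨s', k + 1, .iteFalse ht he, Nat.add_le_add_right hk 1, hs⟩

theorem Runs.loop {t : Test} {I : ℕ → State → Prop} {K : ℕ}
    (hstep : ∀ k < K, ∀ s, I k s → t.Holds s ∧ Runs P s (I (k + 1)) n)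
    (hend : ∀ s, I K s → ¬ t.Holds s) (h : I 0 s) :
    Runs (.loop t P) s (I K) (K * (n + 1) + 1) := by
  suffices H : ∀ j k, k + j = K → ∀ s, I k s → Runs (.loop t P) s (I K) (j * (n + 1) + 1) from
    H K 0 (Nat.zero_add K) s h
  intro j
  induction j with
  | zero =>
    rintro k rfl s hs
    exact ⟨s, 1, .loopDone (hend s hs), Nat.le_add_left _ _, hs⟩
  | succ j ih =>
    intro k hk s hs
    obtain ⟨ht, s', i, he, hi, hs'⟩ := hstep k (by omega) s hs
    obtain ⟨s'', i', he', hi', hs''⟩ := ih (k + 1) (by omega) s' hs'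
    exact ⟨s'', i + i' + 1, .loopStep ht he he', by rw [Nat.succ_mul]; omega, hs''⟩

/-- The effect of straight-line code. -/
def applyAll : List Instr → State → State
  | [], s => s
  | i :: l, s => applyAll l (i.apply s)

/-- Straight-line code. -/
def block : List Instr → Prog
  | [] => .skip
  | i :: l => .seq (.instr i) (block l)

theorem runs_block {l : List Instr} (h : Q (applyAll l s)) :
    Runs (block l) s Q (l.length + 1) := by
  induction l generalizing s with
  | nil => exact ⟨s, 1, .skip s, le_rfl, h⟩
  | cons i l ih =>
    obtain ⟨s', k, he, hk, hs⟩ := ih h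
    exact ⟨s', 1 + k, .seq (.instr i s) he, by rw [List.length_cons]; omega, hs⟩

theorem runs_block_seq {l : List Instr} (h : Runs P (applyAll l s) Q n) :
    Runs (.seq (block l) P) s Q (l.length + 1 + n) :=
  Runs.seq (runs_block rfl) (by rintro _ rfl; exact h)

theorem Frame.of_block (l : List Instr) (s : State) : Frame (block l) s (applyAll l s) := by
  obtain ⟨_, _, _, _, rfl, hf⟩ := (runs_block (Q := (· = applyAll l s)) rfl).frame
  exact hf

end Runs

/-! ### The program -/

-- The numbers of the registers and arrays of the input and output are those of the protocol:
-- `initState`, `receiveContext`, `receiveOutcome` and `Implements`.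

namespace Idx

@[simp] abbrev dim : ℕ := 0
@[simp] abbrev horizon : ℕ := 1
@[simp] abbrev mesh : ℕ := 2
@[simp] abbrev forecast : ℕ := 3
@[simp] abbrev one : ℕ := 4
@[simp] abbrev row : ℕ := 5
@[simp] abbrev cell : ℕ := 6
@[simp] abbrev coord : ℕ := 7
@[simp] abbrev rows : ℕ := 8
@[simp] abbrev crossing : ℕ := 9
@[simp] abbrev lower : ℕ := 10
@[simp] abbrev upper : ℕ := 11
@[simp] abbrev overshoot : ℕ := 12
@[simp] abbrev root : ℕ := 13

end Idx

namespace Acc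

@[simp] abbrev label : ℕ := 1
@[simp] abbrev initScale : ℕ := 2
@[simp] abbrev target : ℕ := 3
@[simp] abbrev candidate : ℕ := 4
@[simp] abbrev power : ℕ := 5
@[simp] abbrev feature : ℕ := 6
@[simp] abbrev entry : ℕ := 7
@[simp] abbrev sum : ℕ := 8
@[simp] abbrev scale : ℕ := 9
@[simp] abbrev zero : ℕ := 10
@[simp] abbrev left : ℕ := 11
@[simp] abbrev right : ℕ := 12
@[simp] abbrev mixing : ℕ := 13
@[simp] abbrev weight : ℕ := 14
@[simp] abbrev error : ℕ := 15

end Acc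

namespace Arr

@[simp] abbrev context : ℕ := 0
@[simp] abbrev weights : ℕ := 1
@[simp] abbrev entries : ℕ := 2
/-- The scales minus the initial scale, so that the zeroed memory is correct at the start. -/
@[simp] abbrev excess : ℕ := 3
@[simp] abbrev correlations : ℕ := 4

end Arr

local infixr:60 ";;" => Prog.seq

/-- Runs `P` for the values `0, 1, …` of register `i` below register `n`. -/
def countTo (i n : ℕ) (P : Prog) : Prog :=
  block [.setIdx i 0] ;; .loop (.idxLt i n) (P ;; block [.addIdx i i Idx.one])

theorem runs_countTo {P : Prog} {i n K c : ℕ} {I : ℕ → State → Prop} {s : State}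
    (hone : s.idx Idx.one = 1) (hn : s.idx n = K) (hi : P.writes (.idx i) = false)
    (hone' : (countTo i n P).writes (.idx Idx.one) = false)
    (hn' : (countTo i n P).writes (.idx n) = false)
    (hI : ∀ k s j, I k s → I k { s with idx := Function.update s.idx i j }) (h0 : I 0 s)
    (hstep : ∀ k < K, ∀ s', Frame (countTo i n P) s s' → s'.idx i = k → I k s' →
      Runs P s' (I (k + 1)) c) :
    Runs (countTo i n P) s (I K) (K * (c + 3) + 3) := by
  have frame_init : Frame (countTo i n P) s { s with idx := Function.update s.idx i 0 } :=
    (Frame.apply (.setIdx i 0) s).mono fun x hx => by simp_all [countTo, block, Prog.writes]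
  have frame_body {s' s''} (h : Frame (P ;; block [.addIdx i i Idx.one]) s' s'') :
      Frame (countTo i n P) s' s'' :=
    h.mono fun x hx => by simp_all [countTo, block, Prog.writes]
  have hP : P.writes (.idx Idx.one) = false := by simp_all [countTo, block, Prog.writes]
  refine Runs.mono (Runs.seq (R := fun s' => Frame (countTo i n P) s s' ∧ s'.idx i = 0 ∧ I 0 s')
    (runs_block ⟨frame_init, by simp [applyAll, Instr.apply], hI _ _ _ h0⟩) fun s' hs' =>
    Runs.loop (I := fun k s' => Frame (countTo i n P) s s' ∧ s'.idx i = k ∧ I k s') (n := c + 2)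
      ?_ ?_ hs') (fun _ h => h.2.2)
    (by simp only [List.length_singleton, Nat.add_assoc, Nat.reduceAdd]; omega)
  · rintro k hk s' ⟨hf, hik, hs'⟩
    refine ⟨by rwa [Test.Holds, hik, hf.idx hn', hn], ?_⟩
    have hbody : Runs (P ;; block [.addIdx i i Idx.one]) s'
        (fun s'' => s''.idx i = k + 1 ∧ I (k + 1) s'') (c + 2) :=
      (hstep k hk s' hf hik hs').frame.seq fun s'' ⟨h, hf'⟩ => runs_block
        ⟨by simp [applyAll, Instr.apply, hf'.idx hi, hf'.idx hP, hf.idx hone', hik, hone],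
          hI _ _ _ h⟩
    exact hbody.frame.mono (fun s'' h => ⟨hf.trans (frame_body h.2), h.1⟩) le_rfl
  · rintro s' ⟨hf, hiK, -⟩
    rw [Test.Holds, hiK, hf.idx hn', hn]
    exact lt_irrefl K

/-- Computes the `j`-th power of the index in register `i`. -/
def powerOf (j i : ℕ) : List Instr :=
  .cast Acc.candidate i :: .cast Acc.power Idx.one ::
    List.replicate j (.arith .mul Acc.power Acc.power Acc.candidate)

/-- Searches for the smallest positive index whose `j`-th power is at least the target. -/
def searchRoot (j i : ℕ) : Prog :=
  block (.setIdx i 1 :: powerOf j i) ;;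
    .loop (.accLt Acc.power Acc.target) (block (.addIdx i i Idx.one :: powerOf j i))

/-- Computes `mesh`, `initScale` and the number of rows. -/
def setupProg : Prog :=
  block [.setIdx Idx.one 1, .cast Acc.target Idx.horizon] ;; searchRoot 3 Idx.mesh ;;
    block [.addIdx Idx.rows Idx.mesh Idx.one, .cast Acc.target Idx.dim] ;; searchRoot 2 Idx.root ;;
    block [.cast Acc.initScale Idx.mesh,
      .arith .mul Acc.initScale Acc.initScale Acc.candidate]

theorem applyAll_powerOf (j i : ℕ) {s : State} (hone : s.idx Idx.one = 1) :
    applyAll (powerOf j i) s =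
      { s with
        acc := Function.update (Function.update s.acc Acc.candidate (s.idx i)) Acc.power
          ((s.idx i : ℝ) ^ j) } := by
  have hmul (j : ℕ) (s : State) :
      applyAll (List.replicate j (.arith .mul Acc.power Acc.power Acc.candidate)) s =
        { s with
          acc := Function.update s.acc Acc.power
            (s.acc Acc.power * s.acc Acc.candidate ^ j) } := by
    induction j generalizing s with
    | zero => simp [applyAll]
    | succ j ih =>
      simp [List.replicate_succ, applyAll, ih, Instr.apply, ArithOp.eval, pow_succ', mul_assoc]
  simp [powerOf, applyAll, hmul, Instr.apply, hone]

/-- The state in which the search for a root leaves the memory if it stops at `k`. -/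
def searchState (s : State) (j i k : ℕ) : State :=
  { s with
    idx := Function.update s.idx i k
    acc := Function.update (Function.update s.acc Acc.candidate k) Acc.power ((k : ℝ) ^ j) }

theorem applyAll_powerOf_setIdx {j i k : ℕ} (hi : i ≠ Idx.one) {s : State}
    (hone : s.idx Idx.one = 1) :
    applyAll (powerOf j i) { s with idx := Function.update s.idx i k } =
      searchState s j i k := by
  rw [applyAll_powerOf _ _ (by simpa [Function.update_of_ne hi.symm] using hone)]
  simp [searchState]

theorem searchState_idx_one {j i k : ℕ} (hi : i ≠ Idx.one) {s : State}
    (hone : s.idx Idx.one = 1) :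
    (searchState s j i k).idx Idx.one = 1 :=
  (Function.update_of_ne hi.symm _ _).trans hone

theorem searchState_searchState (s : State) (j i k k' : ℕ) :
    searchState (searchState s j i k) j i k' = searchState s j i k' := by
  simp only [searchState, Function.update_idem, State.mk.injEq, and_true, true_and]
  funext a
  simp only [Function.update_apply]
  split_ifs <;> rfl

theorem applyAll_addIdx_powerOf {j i k : ℕ} (hi : i ≠ Idx.one) {s : State}
    (hone : s.idx Idx.one = 1) :
    applyAll (.addIdx i i Idx.one :: powerOf j i) (searchState s j i k) =
      searchState s j i (k + 1) := by
  have hone' := searchState_idx_one (j := j) (k := k) hi hone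
  rw [← searchState_searchState s j i k (k + 1), ← applyAll_powerOf_setIdx hi hone']
  simp only [applyAll, Instr.apply, hone']
  simp [searchState]

theorem runs_searchRoot {j i N : ℕ} (hj : 0 < j) (hN : 0 < N) (hi : i ≠ Idx.one) {s : State}
    (hone : s.idx Idx.one = 1) (htarget : s.acc Acc.target = N) :
    Runs (searchRoot j i) s (· = searchState s j i (ceilRoot j N)) ((j + 5) * ceilRoot j N) := by
  obtain ⟨K, hK⟩ : ∃ K, ceilRoot j N = K + 1 := Nat.exists_eq_add_one.2 (ceilRoot_pos hj hN)
  have hlen (x : Instr) : (x :: powerOf j i).length = j + 3 := by simp [powerOf]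
  refine Runs.mono (Runs.seq (R := (· = searchState s j i 1)) (runs_block ?_) fun s' hs' =>
    Runs.loop (I := fun k s' => s' = searchState s j i (k + 1)) (K := K) (n := j + 4) ?_ ?_ hs')
    (by simp [hK]) (by rw [hK, hlen]; ring_nf; omega)
  · exact applyAll_powerOf_setIdx hi hone
  · rintro k hk _ rfl
    have hlt : (k + 1) ^ j < N := (lt_ceilRoot_iff hj).1 (by omega)
    exact ⟨by simpa [Test.Holds, searchState, htarget] using mod_cast hlt,
      Runs.mono (runs_block (applyAll_addIdx_powerOf hi hone)) (fun _ h => h) (by rw [hlen])⟩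
  · rintro _ rfl
    have hge : N ≤ (K + 1) ^ j := not_lt.1 fun h => ((lt_ceilRoot_iff hj).2 h).ne' hK
    simpa [Test.Holds, searchState, htarget] using mod_cast hge

/-- Starts at the entry `Idx.cell`, and leaves `Idx.cell` at the start of the next row. The
machine has no real constants, so `0` is obtained by subtracting a register from itself. -/
def dotProduct : Prog :=
  block [.arith .sub Acc.sum Acc.sum Acc.sum] ;; countTo Idx.coord Idx.dim
    (block [.load Acc.feature Arr.context Idx.coord, .load Acc.entry Arr.entries Idx.cell,
      .arith .mul Acc.entry Acc.feature Acc.entry, .arith .add Acc.sum Acc.sum Acc.entry,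
      .addIdx Idx.cell Idx.cell Idx.one])

/-- Stores the correlation of the context with a row, clears the weight of the row, and records the
row in `Idx.crossing` if the correlation is positive. -/
def correlateRow : Prog :=
  dotProduct ;;
    block [.load Acc.scale Arr.excess Idx.row, .arith .add Acc.scale Acc.scale Acc.initScale,
      .arith .div Acc.sum Acc.sum Acc.scale, .store Arr.correlations Idx.row Acc.sum,
      .arith .sub Acc.zero Acc.zero Acc.zero, .store Arr.weights Idx.row Acc.zero] ;;
    .ite (.accLt Acc.zero Acc.sum) (block [.addIdx Idx.crossing Idx.row Idx.one]) (block [])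

def correlateAll : Prog :=
  block [.setIdx Idx.cell 0, .setIdx Idx.crossing 0] ;; countTo Idx.row Idx.rows correlateRow

/-- Finds the two neighbours of the crossing; `upper` is a minimum, which truncated subtraction
provides without a test. -/
def locateCrossing : Prog :=
  block [.subIdx Idx.lower Idx.crossing Idx.one, .subIdx Idx.overshoot Idx.crossing Idx.mesh,
    .subIdx Idx.upper Idx.crossing Idx.overshoot,
    .load Acc.left Arr.correlations Idx.lower, .load Acc.right Arr.correlations Idx.upper]

def computeMixing : Prog :=
  .ite (.idxLt Idx.lower Idx.upper)
    (block [.arith .sub Acc.right Acc.left Acc.right, .arith .div Acc.mixing Acc.left Acc.right])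
    (block [.arith .sub Acc.mixing Acc.mixing Acc.mixing])

/-- The second weight is added to the table, because the two neighbours may coincide. -/
def writeWeights : Prog :=
  block [.cast Acc.weight Idx.one, .arith .sub Acc.weight Acc.weight Acc.mixing,
    .store Arr.weights Idx.lower Acc.weight, .load Acc.weight Arr.weights Idx.upper,
    .arith .add Acc.weight Acc.weight Acc.mixing, .store Arr.weights Idx.upper Acc.weight]

def predictProg : Prog := correlateAll ;; locateCrossing ;; computeMixing ;; writeWeights

/-- The set-up provides these registers, and no round writes to them. -/
structure Config (d m : ℕ) (c : ℝ) (s : State) : Prop where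
  dim : s.idx Idx.dim = d
  mesh : s.idx Idx.mesh = m
  one : s.idx Idx.one = 1
  rows : s.idx Idx.rows = m + 1
  initScale : s.acc Acc.initScale = c

/-- The memory holds the accumulators `M`, their sums row by row in a single array. -/
structure Represents {d m : ℕ} (c : ℝ) (M : Fin (m + 1) → Accumulator (EuclideanSpace ℝ (Fin d)))
    (s : State) : Prop extends Config d m c s where
  entries : ∀ (p : Fin (m + 1)) (i : Fin d), s.arr Arr.entries (p * d + i) = (M p).total i
  excess : ∀ p : Fin (m + 1), s.arr Arr.excess p + c = (M p).scale

section Predict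

variable {d m : ℕ} {c : ℝ} {s s' : State} {P : Prog}

theorem Config.frame (h : Config d m c s) (hf : Frame P s s')
    (hP : ∀ x ∈ [.idx Idx.dim, .idx Idx.mesh, .idx Idx.one, .idx Idx.rows, .acc Acc.initScale],
      P.writes x = false) : Config d m c s' := by
  simp only [List.forall_mem_cons] at hP
  exact ⟨(hf.idx hP.1).trans h.dim, (hf.idx hP.2.1).trans h.mesh, (hf.idx hP.2.2.1).trans h.one,
    (hf.idx hP.2.2.2.1).trans h.rows, (hf.acc hP.2.2.2.2.1).trans h.initScale⟩

theorem Represents.frame {M : Fin (m + 1) → Accumulator (EuclideanSpace ℝ (Fin d))}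
    (h : Represents c M s) (hf : Frame P s s')
    (hP : ∀ x ∈ [.idx Idx.dim, .idx Idx.mesh, .idx Idx.one, .idx Idx.rows, .acc Acc.initScale],
      P.writes x = false)
    (hP' : ∀ x ∈ [.arr Arr.entries, .arr Arr.excess], P.writes x = false) :
    Represents c M s' := by
  simp only [List.forall_mem_cons] at hP'
  exact ⟨h.toConfig.frame hf hP, by simpa only [hf.arr hP'.1] using h.entries,
    by simpa only [hf.arr hP'.2.1] using h.excess⟩

theorem runs_dotProduct {a : ℕ} (hs : Config d m c s) (hcell : s.idx Idx.cell = a) :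
    Runs dotProduct s
      (fun s' => s'.idx Idx.cell = a + d ∧ s'.acc Acc.sum =
        ∑ i ∈ Finset.range d, s.arr Arr.context i * s.arr Arr.entries (a + i)) (9 * d + 5) := by
  refine Runs.mono (runs_block_seq (runs_countTo (c := 6) (K := d)
    (I := fun k s' => s'.idx Idx.cell = a + k ∧ s'.acc Acc.sum =
      ∑ i ∈ Finset.range k, s.arr Arr.context i * s.arr Arr.entries (a + i))
    hs.one hs.dim rfl rfl rfl (fun _ _ _ => id)
    ⟨hcell, by simp [applyAll, Instr.apply, ArithOp.eval]⟩ ?_)) (fun _ => id)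
    (by simp only [List.length_singleton]; omega)
  rintro k - s' hf hk ⟨hcell', hsum'⟩
  have hcontext := hf.arr (A := Arr.context) rfl
  have hentries := hf.arr (A := Arr.entries) rfl
  have hone' : s'.idx Idx.one = 1 := (hf.idx rfl).trans hs.one
  refine runs_block ⟨?_, ?_⟩
  · simp [applyAll, Instr.apply, hcell', hone', add_assoc]
  · simp [applyAll, Instr.apply, ArithOp.eval, Finset.sum_range_succ, hcell', hsum', hcontext,
      hentries, hk]

variable {M : Fin (m + 1) → Accumulator (EuclideanSpace ℝ (Fin d))} {x : Context d}

theorem Represents.correlation_eq (hM : Represents c M s)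
    (hx : ∀ i : Fin d, s.arr Arr.context i = x i) (p : Fin (m + 1)) :
    (M p).correlation (coords x) =
      (∑ i ∈ Finset.range d, s.arr Arr.context i * s.arr Arr.entries (p * d + i)) /
        (s.arr Arr.excess p + c) := by
  rw [Accumulator.correlation, hM.excess, Finset.sum_range, PiLp.inner_apply]
  simp [hM.entries, hx, coords]

theorem runs_correlateRow (hM : Represents c M s) (hx : ∀ i : Fin d, s.arr Arr.context i = x i)
    {p : Fin (m + 1)} (hrow : s.idx Idx.row = p) (hcell : s.idx Idx.cell = p * d) :
    Runs correlateRow s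
      (fun s' => s'.idx Idx.cell = (p + 1) * d ∧
        s'.idx Idx.crossing =
          (if 0 < (M p).correlation (coords x) then (p : ℕ) + 1 else s.idx Idx.crossing) ∧
        s'.arr Arr.correlations =
          Function.update (s.arr Arr.correlations) p ((M p).correlation (coords x)) ∧
        s'.arr Arr.weights = Function.update (s.arr Arr.weights) p 0) (9 * d + 15) := by
  refine (runs_dotProduct hM.toConfig hcell).frame.seq (n' := 10) ?_
  rintro s₁ ⟨⟨hcell₁, hsum₁⟩, hf⟩
  have hrow₁ : s₁.idx Idx.row = p := (hf.idx rfl).trans hrow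
  have hone₁ : s₁.idx Idx.one = 1 := (hf.idx rfl).trans hM.one
  have hcrossing₁ := hf.idx (i := Idx.crossing) rfl
  have hcorrelations₁ := hf.arr (A := Arr.correlations) rfl
  have hweights₁ := hf.arr (A := Arr.weights) rfl
  have hquotient : s₁.acc Acc.sum / (s₁.arr Arr.excess p + s₁.acc Acc.initScale) =
      (M p).correlation (coords x) := by
    rw [hM.correlation_eq hx, hsum₁, hf.arr rfl, hf.acc rfl, hM.initScale]
  refine runs_block_seq (Runs.ite (fun hpos => runs_block ?_)
    (fun hnonpos => (runs_block ?_).mono (fun _ => id) one_le_two))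
  · replace hpos : 0 < (M p).correlation (coords x) := by
      simpa [Test.Holds, applyAll, Instr.apply, ArithOp.eval, hrow₁, hquotient] using hpos
    simp [applyAll, Instr.apply, ArithOp.eval, hrow₁, hone₁, hcell₁, hcorrelations₁, hweights₁,
      hquotient, hpos, add_mul]
  · replace hnonpos : ¬ 0 < (M p).correlation (coords x) := by
      simpa [Test.Holds, applyAll, Instr.apply, ArithOp.eval, hrow₁, hquotient] using hnonpos
    simp [applyAll, Instr.apply, ArithOp.eval, hrow₁, hcell₁, hcrossing₁, hcorrelations₁,
      hweights₁, hquotient, hnonpos, add_mul]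

theorem runs_correlateAll (hM : Represents c M s) (hx : ∀ i : Fin d, s.arr Arr.context i = x i) :
    Runs correlateAll s
      (fun s' => s'.idx Idx.crossing = crossing (fun p => (M p).correlation (coords x)) ∧
        ∀ p : Fin (m + 1), s'.arr Arr.correlations p = (M p).correlation (coords x) ∧
          s'.arr Arr.weights p = 0) ((m + 1) * (9 * d + 18) + 6) := by
  refine Runs.mono (runs_block_seq (runs_countTo (K := m + 1) (c := 9 * d + 15)
    (I := fun k s' => s'.idx Idx.cell = k * d ∧
      s'.idx Idx.crossing = lastPos (fun p => (M p).correlation (coords x)) k ∧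
      ∀ p : Fin (m + 1), (p : ℕ) < k →
        s'.arr Arr.correlations p = (M p).correlation (coords x) ∧ s'.arr Arr.weights p = 0)
    hM.one hM.rows rfl rfl rfl (fun _ _ _ => id)
    ⟨by simp [applyAll, Instr.apply], by simp [applyAll, Instr.apply, lastPos_zero], by simp⟩
    ?_)) (fun s' h => ⟨h.2.1, fun p => h.2.2 p p.isLt⟩)
    (by simp only [List.length_cons, List.length_nil]; ring_nf; omega)
  intro k hk s' hf hrow ⟨hcell, hcrossing, hwritten⟩
  have hM' : Represents c M s' :=
    (hM.frame (.of_block _ _) (by decide) (by decide)).frame hf (by decide) (by decide)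
  lift k to Fin (m + 1) using hk
  have hx' (i : Fin d) : s'.arr Arr.context i = x i := by
    rw [hf.arr rfl]
    exact hx i
  refine (runs_correlateRow hM' hx' hrow hcell).mono ?_ le_rfl
  rintro s'' ⟨hcell'', hcrossing'', hcorr'', hweights''⟩
  refine ⟨hcell'', by rw [hcrossing'', hcrossing, lastPos_add_one], fun p hp => ?_⟩
  rcases (Nat.lt_succ_iff.1 hp).eq_or_lt with h | h
  · rw [Fin.ext h]
    simp [hcorr'', hweights'']
  · simpa [hcorr'', hweights'', Function.update_of_ne h.ne] using hwritten p h

theorem runs_locateCrossing {f : Fin (m + 1) → ℝ} (hs : Config d m c s)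
    (hcrossing : s.idx Idx.crossing = crossing f)
    (hf : ∀ p : Fin (m + 1), s.arr Arr.correlations p = f p) :
    Runs locateCrossing s (fun s' => s'.idx Idx.lower = lower f ∧ s'.idx Idx.upper = upper f ∧
      s'.acc Acc.left = f (lower f) ∧ s'.acc Acc.right = f (upper f)) 6 := by
  have hlower : crossing f - 1 = (lower f : ℕ) := rfl
  have hupper : crossing f - (crossing f - m) = (upper f : ℕ) := Nat.sub_sub_eq_min _ _
  refine runs_block ⟨?_, ?_, ?_, ?_⟩ <;>
    simp [applyAll, Instr.apply, hcrossing, hs.one, hs.mesh, hlower, hupper, hf]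

theorem runs_computeMixing {f : Fin (m + 1) → ℝ} (hlower : s.idx Idx.lower = lower f)
    (hupper : s.idx Idx.upper = upper f) (hleft : s.acc Acc.left = f (lower f))
    (hright : s.acc Acc.right = f (upper f)) :
    Runs computeMixing s (fun s' => s'.acc Acc.mixing = mixing f) 4 := by
  have hlt : (Test.idxLt Idx.lower Idx.upper).Holds s ↔ lower f < upper f := by
    rw [Test.Holds, hlower, hupper, Fin.lt_def]
  refine Runs.ite (fun h => runs_block ?_)
    (fun h => (runs_block ?_).mono (fun _ => id) (Nat.le_succ 2))
  · simp [applyAll, Instr.apply, ArithOp.eval, hleft, hright, mixing, hlt.1 h]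
  · simp [applyAll, Instr.apply, ArithOp.eval, mixing, mt hlt.2 h]

theorem runs_writeWeights {f : Fin (m + 1) → ℝ} (hone : s.idx Idx.one = 1)
    (hlower : s.idx Idx.lower = lower f) (hupper : s.idx Idx.upper = upper f)
    (hmixing : s.acc Acc.mixing = mixing f)
    (hzero : ∀ p : Fin (m + 1), s.arr Arr.weights p = 0) :
    Runs writeWeights s (fun s' => ∀ p : Fin (m + 1), s'.arr Arr.weights p = weights f p) 7 := by
  refine runs_block fun p => ?_
  simp only [applyAll, Instr.apply, Acc.weight, Idx.one, hone, Nat.cast_one, ArithOp.eval,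
    Function.update_self, Acc.mixing, ne_eq, Nat.reduceEqDiff, not_false_eq_true,
    Function.update_of_ne, hmixing, Function.update_idem, Arr.weights, Idx.lower, hlower,
    Idx.upper, hupper, Function.update_apply, hzero, weights_apply, Pi.single_apply, Fin.ext_iff,
    mul_ite, mul_one, mul_zero]
  split_ifs <;> simp_all

theorem runs_predictProg (hM : Represents c M s) (hx : ∀ i : Fin d, s.arr Arr.context i = x i) :
    Runs predictProg s
      (fun s' => ∀ p : Fin (m + 1), s'.arr Arr.weights p =
        weights (fun p => (M p).correlation (coords x)) p) ((m + 1) * (9 * d + 18) + 23) := by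
  refine Runs.mono ((runs_correlateAll hM hx).frame.seq (n' := 17) ?_) (fun _ => id) le_rfl
  rintro s₁ ⟨⟨hcrossing, htable⟩, hf₁⟩
  have hM₁ : Represents c M s₁ := hM.frame hf₁ (by decide) (by decide)
  refine (runs_locateCrossing hM₁.toConfig hcrossing fun p => (htable p).1).frame.seq (n' := 11) ?_
  rintro s₂ ⟨⟨hlower, hupper, hleft, hright⟩, hf₂⟩
  refine (runs_computeMixing hlower hupper hleft hright).frame.seq (n' := 7) ?_
  rintro s₃ ⟨hmixing, hf₃⟩
  exact runs_writeWeights ((hf₃.idx rfl).trans ((hf₂.idx rfl).trans hM₁.one))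
    ((hf₃.idx rfl).trans hlower) ((hf₃.idx rfl).trans hupper) hmixing
    fun p => by rw [hf₃.arr rfl, hf₂.arr rfl, (htable p).2]

end Predict

/-- Computes `y - p` and the offset of the row of `p` in the table of entries. -/
def computeError : Prog :=
  block [.cast Acc.error Idx.forecast, .cast Acc.target Idx.mesh,
    .arith .div Acc.error Acc.error Acc.target, .arith .sub Acc.error Acc.label Acc.error,
    .setIdx Idx.cell 0] ;;
  countTo Idx.row Idx.forecast (block [.addIdx Idx.cell Idx.cell Idx.dim])

/-- Adds the residual of the round to a row, and sums the squares of the new entries. -/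
def updateRow : Prog :=
  block [.arith .sub Acc.sum Acc.sum Acc.sum] ;; countTo Idx.coord Idx.dim
    (block [.load Acc.feature Arr.context Idx.coord,
      .arith .mul Acc.feature Acc.error Acc.feature, .load Acc.entry Arr.entries Idx.cell,
      .arith .add Acc.entry Acc.entry Acc.feature, .store Arr.entries Idx.cell Acc.entry,
      .arith .mul Acc.entry Acc.entry Acc.entry, .arith .add Acc.sum Acc.sum Acc.entry,
      .addIdx Idx.cell Idx.cell Idx.one])

def updateScale : Prog :=
  block [.load Acc.scale Arr.excess Idx.forecast, .arith .add Acc.scale Acc.scale Acc.initScale,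
    .arith .div Acc.sum Acc.sum Acc.scale] ;;
  .ite (.accLt Acc.scale Acc.sum)
    (block [.arith .sub Acc.sum Acc.sum Acc.initScale, .store Arr.excess Idx.forecast Acc.sum])
    (block [])

def updateProg : Prog := computeError ;; updateRow ;; updateScale

section Update

variable {d m : ℕ} {c : ℝ} {s : State}

theorem runs_computeError (hs : Config d m c s) :
    Runs computeError s
      (fun s' => s'.acc Acc.error = s.acc Acc.label - s.idx Idx.forecast / m ∧
        s'.idx Idx.cell = s.idx Idx.forecast * d) (5 * s.idx Idx.forecast + 9) := by
  refine Runs.mono (runs_block_seq (runs_countTo (c := 2) (K := s.idx Idx.forecast)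
    (I := fun k s' => s'.acc Acc.error = s.acc Acc.label - s.idx Idx.forecast / m ∧
      s'.idx Idx.cell = k * d)
    hs.one rfl rfl rfl rfl (fun _ _ _ => id)
    ⟨by simp [applyAll, Instr.apply, ArithOp.eval, hs.mesh],
      by simp [applyAll, Instr.apply]⟩ ?_)) (fun _ => id)
    (by simp only [List.length_cons, List.length_nil]; omega)
  intro k _ s' hf _ ⟨herror, hcell⟩
  have hdim : s'.idx Idx.dim = d := (hf.idx rfl).trans hs.dim
  exact runs_block ⟨by simpa [applyAll, Instr.apply] using herror,
    by simp [applyAll, Instr.apply, hcell, hdim, add_mul]⟩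

theorem runs_updateRow {a : ℕ} (hs : Config d m c s) (hcell : s.idx Idx.cell = a) :
    Runs updateRow s
      (fun s' =>
        (∀ i < d, s'.arr Arr.entries (a + i) =
          s.arr Arr.entries (a + i) + s.acc Acc.error * s.arr Arr.context i) ∧
        (∀ n, n < a ∨ a + d ≤ n → s'.arr Arr.entries n = s.arr Arr.entries n) ∧
        s'.acc Acc.sum = ∑ i ∈ Finset.range d,
          (s.arr Arr.entries (a + i) + s.acc Acc.error * s.arr Arr.context i) ^ 2)
      (12 * d + 5) := by
  refine Runs.mono (runs_block_seq (runs_countTo (c := 9) (K := d)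
    (I := fun k s' => s'.idx Idx.cell = a + k ∧
      (∀ i < k, s'.arr Arr.entries (a + i) =
        s.arr Arr.entries (a + i) + s.acc Acc.error * s.arr Arr.context i) ∧
      (∀ n, n < a ∨ a + k ≤ n → s'.arr Arr.entries n = s.arr Arr.entries n) ∧
      s'.acc Acc.sum = ∑ i ∈ Finset.range k,
        (s.arr Arr.entries (a + i) + s.acc Acc.error * s.arr Arr.context i) ^ 2)
    hs.one hs.dim rfl rfl rfl (fun _ _ _ => id)
    ⟨hcell, by simp, fun _ _ => rfl, by simp [applyAll, Instr.apply, ArithOp.eval]⟩ ?_))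
    (fun _ => And.right) (by simp only [List.length_singleton]; omega)
  intro k _ s' hf hk ⟨hcell', hdone, hrest, hsum⟩
  have hcontext := hf.arr (A := Arr.context) rfl
  have herror := hf.acc (a := Acc.error) rfl
  have hone : s'.idx Idx.one = 1 := (hf.idx rfl).trans hs.one
  have hnew := hrest (a + k) (.inr le_rfl)
  refine runs_block ⟨?_, fun i hi => ?_, fun n hn => ?_, ?_⟩
  · simp [applyAll, Instr.apply, hcell', hone, add_assoc]
  · rcases (Nat.lt_succ_iff.1 hi).eq_or_lt with rfl | hi
    · simp [applyAll, Instr.apply, ArithOp.eval, hcell', hk, hcontext, herror, hnew]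
    · simpa [applyAll, Instr.apply, hcell', hi.ne] using hdone i hi
  · have hne : n ≠ a + k := by omega
    simpa [applyAll, Instr.apply, hcell', Function.update_of_ne hne] using hrest n (by omega)
  · simp [applyAll, Instr.apply, ArithOp.eval, Finset.sum_range_succ, hcell', hk, hcontext, herror,
      hnew, hsum, sq]

theorem runs_updateScale (hs : s.acc Acc.initScale = c) {p : ℕ} (hp : s.idx Idx.forecast = p) :
    Runs updateScale s
      (fun s' => s'.arr Arr.excess = Function.update (s.arr Arr.excess) p
        (max (s.arr Arr.excess p + c) (s.acc Acc.sum / (s.arr Arr.excess p + c)) - c)) 8 := by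
  have htest : (Test.accLt Acc.scale Acc.sum).Holds (applyAll
      [.load Acc.scale Arr.excess Idx.forecast, .arith .add Acc.scale Acc.scale Acc.initScale,
        .arith .div Acc.sum Acc.sum Acc.scale] s) ↔
      s.arr Arr.excess p + c < s.acc Acc.sum / (s.arr Arr.excess p + c) := by
    simp [Test.Holds, applyAll, Instr.apply, ArithOp.eval, hp, hs]
  refine runs_block_seq (Runs.ite (n := 3) (fun h => runs_block ?_)
    (fun h => (runs_block (l := []) ?_).mono (fun _ => id) (Nat.le_add_left 1 2)))
  · simp [applyAll, Instr.apply, ArithOp.eval, hp, hs, max_eq_right (htest.1 h).le]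
  · simp [applyAll, Instr.apply, max_eq_left (not_lt.1 (mt htest.2 h))]

variable {M : Fin (m + 1) → Accumulator (EuclideanSpace ℝ (Fin d))} {x : Context d}

theorem cell_lt_or_le_of_ne {p q : Fin (m + 1)} (h : q ≠ p) (i : Fin d) :
    (q * d + i : ℕ) < p * d ∨ p * d + d ≤ q * d + i := by
  have hi := i.isLt
  rcases lt_or_gt_of_ne (Fin.val_ne_of_ne h) with h | h
  · exact .inl (by nlinarith)
  · exact .inr (by nlinarith)

theorem runs_updateProg (hM : Represents c M s) (hx : ∀ i : Fin d, s.arr Arr.context i = x i)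
    {p : Fin (m + 1)} (hp : s.idx Idx.forecast = p) {y : ℝ} (hy : s.acc Acc.label = y) :
    Runs updateProg s
      (Represents c (Function.update M p ((M p).add ((y - (p : ℝ) / m) • coords x))))
      (5 * p + 12 * d + 22) := by
  refine Runs.mono ((runs_computeError hM.toConfig).frame.seq (n' := 12 * d + 13) ?_)
    (fun _ => id) (by rw [hp]; omega)
  rintro s₁ ⟨⟨herror, hcell⟩, hf₁⟩
  have hM₁ : Represents c M s₁ := hM.frame hf₁ (by decide) (by decide)
  rw [hp] at hcell
  rw [hp, hy] at herror
  have hentry (i : Fin d) : s₁.arr Arr.entries (p * d + i) + s₁.acc Acc.error *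
      s₁.arr Arr.context i = ((M p).total + (y - (p : ℝ) / m) • coords x) i := by
    have hcontext : s₁.arr Arr.context i = x i := by rw [hf₁.arr rfl, hx]
    simp [hM₁.entries, herror, hcontext, coords]
  refine (runs_updateRow hM₁.toConfig hcell).frame.seq (n' := 8) ?_
  rintro s₂ ⟨⟨hrow, hrest, hsum⟩, hf₂⟩
  have hconfig₂ : Config d m c s₂ := hM₁.toConfig.frame hf₂ (by decide)
  have hp₂ : s₂.idx Idx.forecast = p := (hf₂.idx rfl).trans ((hf₁.idx rfl).trans hp)
  have hnorm : s₂.acc Acc.sum = ‖(M p).total + (y - (p : ℝ) / m) • coords x‖ ^ 2 := by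
    rw [hsum, Finset.sum_range, EuclideanSpace.real_norm_sq_eq]
    simp only [hentry]
  refine (runs_updateScale hconfig₂.initScale hp₂).frame.mono ?_ le_rfl
  rintro s₃ ⟨hexcess, hf₃⟩
  refine ⟨hconfig₂.frame hf₃ (by decide), fun q i => ?_, fun q => ?_⟩
  · rw [hf₃.arr rfl]
    rcases eq_or_ne q p with rfl | hq
    · rw [hrow i i.isLt, hentry, Function.update_self, Accumulator.add]
    · rw [hrest _ (cell_lt_or_le_of_ne hq i), hM₁.entries, Function.update_of_ne hq]
  · have hexcess₂ : s₂.arr Arr.excess = s₁.arr Arr.excess := hf₂.arr rfl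
    rw [hexcess, hexcess₂]
    rcases eq_or_ne q p with rfl | hq
    · simp [Accumulator.add, hM₁.excess, hnorm]
    · rw [Function.update_of_ne (Fin.val_ne_of_ne hq), Function.update_of_ne hq, hM₁.excess]

end Update

section Implements

theorem runs_setupProg {d T : ℕ} (hd : 1 ≤ d) (hT : 1 ≤ T) (B : ℝ) :
    Runs setupProg (initState d T B)
      (Represents (initScale d T)
        (ledger (m := mesh T) (coords (d := d)) (initScale d T) []))
      (8 * mesh T + 7 * ceilRoot 2 d + 9) := by
  refine Runs.mono (runs_block_seq ((runs_searchRoot (N := T) three_pos hT (by decide)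
    (by simp [applyAll, Instr.apply])
    (by simp [applyAll, Instr.apply, initState])).seq (n' := 7 * ceilRoot 2 d + 6) ?_))
    (fun _ => id) (by simp only [mesh, List.length_cons, List.length_nil]; omega)
  rintro _ rfl
  refine Runs.mono (runs_block_seq ((runs_searchRoot (N := d) two_pos hd (by decide)
    (by simp [applyAll, Instr.apply, searchState])
    (by simp [applyAll, Instr.apply, searchState, initState])).seq (n' := 3) ?_))
    (fun _ => id) (by simp only [List.length_cons, List.length_nil]; omega)
  rintro _ rfl
  refine runs_block ⟨⟨?_, ?_, ?_, ?_, ?_⟩, ?_, ?_⟩ <;>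
    simp [applyAll, Instr.apply, ArithOp.eval, searchState, initState, ledger, initScale, mesh]

variable {d m : ℕ} {L : Learner d m}

/-- An invariant that relates the history to the memory provides the states of the memory by
recursion on the history. -/
theorem Algorithm.implements_of_invariant {A : Algorithm} {T : ℕ} {B : ℝ} {τ n₁ n₂ : ℕ}
    (Inv : History d m → State → Prop)
    (hsetup : Runs A.setup (initState d T B) (fun s => s.idx 2 = m ∧ Inv [] s) τ)
    (hround : ∀ π s x, Inv π s → Runs A.predict (s.receiveContext x)
      (fun s' => (∀ p : Fin (m + 1), s'.arr 1 p = L π x p) ∧ ∀ (p : Fin (m + 1)) (y : unitInterval),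
        Runs A.update (s'.receiveOutcome p y) (Inv (π ++ [⟨x, p, y⟩])) n₂) n₁)
    (hτ : d + n₁ + (m + 1) + n₂ ≤ τ) : A.Implements d T B L τ := by
  obtain ⟨s₀, k₀, hexec₀, hk₀, hmesh, hinv₀⟩ := hsetup
  choose drawn k₁ hexec₁ hk₁ hdist next k₂ hexec₂ hk₂ hinv using hround
  let σ (π : History d m) : {s // Inv π s} :=
    π.reverseRecOn ⟨s₀, hinv₀⟩ fun π r s => ⟨_, hinv π s.1 r.context s.2 r.pred r.label⟩
  have hσ (π : History d m) (r : Round d m) :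
      (σ (π ++ [r]) : State) = next π (σ π) r.context (σ π).2 r.pred r.label := by
    simp only [σ, List.reverseRecOn_concat]
  have hσ₀ : (σ [] : State) = s₀ := by simp only [σ, List.reverseRecOn_nil]
  refine ⟨fun π => σ π, ⟨k₀, by simpa only [hσ₀], hk₀, by simpa only [hσ₀]⟩, fun π _ x =>
    ⟨_, _, hexec₁ π (σ π) x (σ π).2, hdist _ _ _ _, fun p y =>
      ⟨k₂ π (σ π) x (σ π).2 p y, ?_, ?_⟩⟩⟩
  · simpa only [hσ] using hexec₂ π (σ π) x (σ π).2 p y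
  · have := hk₁ π (σ π) x (σ π).2
    have := hk₂ π (σ π) x (σ π).2 p y
    omega

variable {c : ℝ} {s s' : State} {M : Fin (m + 1) → Accumulator (EuclideanSpace ℝ (Fin d))}

theorem Represents.receiveContext (h : Represents c M s) (x : Context d) :
    Represents c M (s.receiveContext x) where
  __ := h

theorem Represents.receiveOutcome (h : Represents c M s) (p : ℕ) (y : ℝ) :
    Represents c M (s.receiveOutcome p y) where
  __ := h

theorem receiveContext_arr_context (s : State) (x : Context d) (i : Fin d) :
    (s.receiveContext x).arr Arr.context i = x i := by
  simp [State.receiveContext]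

/-- The algorithm that carries out the forecaster. -/
def forecasterAlgorithm : Algorithm where
  setup := setupProg
  predict := predictProg
  update := updateProg

theorem forecasterAlgorithm_implements {d T : ℕ} (hd : 1 ≤ d) (hT : 1 ≤ T) (B : ℝ) :
    forecasterAlgorithm.Implements d T B (forecaster (m := mesh T) coords (initScale d T))
      (stepBound d T) := by
  refine Algorithm.implements_of_invariant (n₁ := (mesh T + 1) * (9 * d + 18) + 23)
    (n₂ := 5 * mesh T + 12 * d + 22)
    (fun π => Represents (initScale d T) (ledger coords (initScale d T) π)) ?_
    (fun π s x hs => ?_) ?_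
  · refine (runs_setupProg hd hT B).mono (fun s hs => ⟨hs.mesh, hs⟩) ?_
    have : ceilRoot 2 d ≤ d := ceilRoot_le_self two_pos
    rw [stepBound]
    nlinarith
  · have hs' := hs.receiveContext x
    have hx := receiveContext_arr_context s x
    refine (runs_predictProg hs' hx).frame.mono (fun s' ⟨hw, hf⟩ => ⟨hw, fun p y => ?_⟩) le_rfl
    have hs'' := (hs'.frame hf (by decide) (by decide)).receiveOutcome p y
    have hx' (i : Fin d) : (s'.receiveOutcome p y).arr Arr.context i = x i :=
      (congrFun (hf.arr rfl) _).trans (hx i)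
    rw [ledger_append_singleton]
    refine (runs_updateProg hs'' hx' (p := p) (y := y) ?_ ?_).mono (fun _ => id) ?_
    · simp [State.receiveOutcome]
    · simp [State.receiveOutcome]
    · have := Nat.lt_succ_iff.1 p.isLt
      omega
  · have : 1 ≤ mesh T := ceilRoot_pos three_pos hT
    rw [stepBound]
    nlinarith

end Implements

end OnlineMC

end

open OnlineMC in
theorem corollary1_general :
    ∃ A : Algorithm, ∀ (d T : ℕ) (B : ℝ), 1 ≤ d → 0 ≤ B → 2 ≤ max 1 B * (T : ℝ) →
      ∃ (m : ℕ) (L : Learner d m) (τ : ℕ), 1 ≤ m ∧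
        A.Implements d T B L τ ∧
        (τ : ℝ) ≤ 768 * (max 1 B * √(T : ℝ)) ^ d ∧
        (3 ≤ d → ((T : ℝ) + 1) * (τ : ℝ) ≤ 768 * (max 1 B * √(T : ℝ)) ^ d) ∧
        ∀ adv : Adversary d m, ∀ H ⊆ innerClass coords B,
          expect L adv (fun π => multiCalError π H) T [] ≤
            10 * (B * √(d : ℝ) * (T : ℝ) ^ (-(1 / 3) : ℝ)) := by
  refine ⟨forecasterAlgorithm, fun d T B hd hB hBT => ?_⟩
  have hT : 1 ≤ T := Nat.one_le_iff_ne_zero.2 fun h => by norm_num [h] at hBT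
  have hX : 2 ≤ (max 1 B * √T) ^ 2 := hBT.trans (max_one_mul_le_sq B T)
  have hTX : (T : ℝ) ≤ (max 1 B * √T) ^ 2 :=
    (le_mul_of_one_le_left T.cast_nonneg (le_max_left 1 B)).trans (max_one_mul_le_sq B T)
  have hX0 : 0 ≤ max 1 B * √T := by positivity
  have hmesh : 1 ≤ mesh T := ceilRoot_pos three_pos hT
  have hscale : 0 < initScale d T :=
    mul_pos (mod_cast hmesh) (mod_cast ceilRoot_pos two_pos hd)
  exact ⟨mesh T, forecaster coords (initScale d T), stepBound d T, hmesh,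
    forecasterAlgorithm_implements hd hT B, stepBound_le_pow hX hX0 hTX hT hd,
    add_one_mul_stepBound_le_pow hX hX0 hTX hT, fun adv H hH =>
    (expect_multiCalError_forecaster_le hmesh hB hscale norm_coords_le hH adv T).trans
      (error_bound_le hd hT hB)⟩

theorem corollary1 :
    ∃ (A : OnlineMC.Algorithm) (C : ℝ), 0 < C ∧
      ∀ (d T : ℕ) (B : ℝ), 1 ≤ d → 1 ≤ T → 0 < B → 2 ≤ B * (T : ℝ) →
        ∃ (m : ℕ) (L : OnlineMC.Learner d m) (τ : ℕ), 1 ≤ m ∧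
          A.Implements d T B L τ ∧
          (τ : ℝ) ≤ C * (max 1 B * √(T : ℝ)) ^ d ∧
          (3 ≤ d → ((T : ℝ) + 1) * (τ : ℝ) ≤ C * (max 1 B * √(T : ℝ)) ^ d) ∧
          ∀ adv : OnlineMC.Adversary d m,
            OnlineMC.expect L adv
                (fun π => OnlineMC.multiCalError π (OnlineMC.linearClass d B)) T [] ≤
              C * (B * √(d : ℝ) * (T : ℝ) ^ (-(1 / 3) : ℝ) * Real.log (B * (T : ℝ))) := by
  obtain ⟨A, hA⟩ := corollary1_general
  refine ⟨A, 768, by norm_num, fun d T B hd _ hB hBT => ?_⟩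
  obtain ⟨m, L, τ, hm, himplements, hround, htotal, herror⟩ :=
    hA d T B hd hB.le (hBT.trans (by gcongr; exact le_max_right 1 B))
  exact ⟨m, L, τ, hm, himplements, hround, htotal, fun adv =>
    (herror adv _ (OnlineMC.linearClass_subset_innerClass d B)).trans
      (OnlineMC.ten_mul_le_mul_log (by positivity) hBT)⟩
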